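/- Let $G$ be a discrete group, and let $\ell^1(G)$ carry the pointwise product and its natural operator space structure (as the predual of $\ell^\infty(G)$). Let $\lambda$ be the left regular representation of $G$ on $\ell^2(G)$, and let $VN(G)\subseteq B(\ell^2(G))$ be the closure of $\operatorname{span}\{\lambda(s):s\in G\}$ in the weak operator topology. Then $\ell^1(G)$ acts on $VN(G)$ by $$f\cdot T=\sum_{s\in G} f(s)\,\langle T\delta_e,\delta_s\rangle\,\lambda(s)\qquad(f\in \ell^1(G),\ T\in VN(G)),$$ so that $f\cdot\lambda(g)=\lambda(fg)$ for $f,g\in\ell^1(G)$, where $\lambda(g)=\sum_s g(s)\lambda(s)$. Let $C^*(G)$ be the full group C*-algebra, that is, the completion of $\ell^1(G)$ in the norm $\|f\|_*=\sup_\pi\|\pi(f)\|$ over all unitary representations $\pi$ of $G$. Let $i:\ell^1(G)\to C^*(G)$ be the canonical embedding; $\ell^1(G)$ acts on $C^*(G)$ by $f\cdot i(g)=i(fg)$. Let $A$ be a completely contractive Banach algebra. A completely bounded left $A$-module is a (complete) operator space $E$ with a left action of $A$ which is completely bounded as a map $A\widehat\otimes E\to E$, where $\widehat\otimes$ is the operator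 space projective tensor product. These modules form the category $A$-$\mathbf{mod}$, whose morphisms are the completely bounded $A$-module maps. Such a map $T:E\to F$ is admissible if $\ker T$ is completely complemented in $E$ (the range of a completely bounded projection) and the range of $T$ is closed and completely complemented in $F$. A module $X$ is operator projective in $A$-$\mathbf{mod}$ if for every admissible surjective $T:E\to F$ in $A$-$\mathbf{mod}$ and every morphism $S:X\to F$ there is a morphism $R:X\to E$ with $T\circ R=S$. Then: 1. Let $X$ be a norm-closed $\ell^1(G)$-submodule of $VN(G)$, with the inherited operator space structure, which contains $\{\lambda(s):s\in G\}$. Then $X$ is operator projective in $\ell^1(G)$-$\mathbf{mod}$ if and only if $G$ is finite. 2. $C^*(G)$ is operator projective in $\ell^1(G)$-$\mathbf{mod}$ if and only if $G$ is finite. Both statements also hold if, in the definition of operator projectivity, only those morphisms $T:E\to F$ are considered which have a completely bounded linear right inverse. -/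

import Mathlib

namespace OpMod

open scoped InnerProductSpace

noncomputable section

universe u v w

/-! ### Matrices of operators on a Hilbert space -/

/-- The operator on the Hilbert space direct sum `H^ι` given by a matrix of operators on `H`. -/
def matOp {ι : Type*} [Fintype ι] {H : Type*} [NormedAddCommGroup H] [InnerProductSpace ℂ H]
    (M : Matrix ι ι (H →L[ℂ] H)) :
    PiLp 2 (fun _ : ι => H) →L[ℂ] PiLp 2 (fun _ : ι => H) :=
  (PiLp.continuousLinearEquiv 2 ℂ (fun _ : ι => H)).symm.toContinuousLinearMap ∘L
    ContinuousLinearMap.pi (fun i => ∑ j, M i j ∘L PiLp.proj 2 (fun _ : ι => H) j)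

/-- The product `α A β` of a matrix over a vector space with two scalar matrices. -/
def sandwich {m n : ℕ} {V : Type*} [AddCommGroup V] [Module ℂ V]
    (a : Matrix (Fin m) (Fin n) ℂ) (A : Matrix (Fin n) (Fin n) V) (b : Matrix (Fin n) (Fin m) ℂ) :
    Matrix (Fin m) (Fin m) V :=
  fun i j => ∑ k, ∑ l, (a i k * b l j) • A k l

/-- The block diagonal matrix `A ⊕ B`. -/
def blockDiag {m n : ℕ} {V : Type*} [Zero V] (A : Matrix (Fin m) (Fin m) V)
    (B : Matrix (Fin n) (Fin n) V) : Matrix (Fin (m + n)) (Fin (m + n)) V :=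
  Matrix.reindex finSumFinEquiv finSumFinEquiv (Matrix.fromBlocks A 0 0 B)

/-- An operator space structure on a normed space `V`: norms on all `M_n(V)`, extending the norm
of `V = M_1(V)`, which satisfy Ruan's axioms. The norm of a scalar matrix is its operator norm on
`ℂⁿ`. If `V` is complete, then so are all `M_n(V)`. -/
class OperatorSpace (V : Type v) [NormedAddCommGroup V] [NormedSpace ℂ V] where
  matNorm : ∀ {n : ℕ}, Matrix (Fin n) (Fin n) V → ℝ
  matNorm_add_le : ∀ {n : ℕ} (A B : Matrix (Fin n) (Fin n) V),
    matNorm (A + B) ≤ matNorm A + matNorm B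
  matNorm_smul : ∀ {n : ℕ} (c : ℂ) (A : Matrix (Fin n) (Fin n) V),
    matNorm (c • A) = ‖c‖ * matNorm A
  eq_zero_of_matNorm : ∀ {n : ℕ} (A : Matrix (Fin n) (Fin n) V), matNorm A = 0 → A = 0
  matNorm_one : ∀ x : V, matNorm (Matrix.of fun _ _ : Fin 1 => x) = ‖x‖
  matNorm_blockDiag : ∀ {m n : ℕ} (A : Matrix (Fin m) (Fin m) V) (B : Matrix (Fin n) (Fin n) V),
    matNorm (blockDiag A B) = max (matNorm A) (matNorm B)
  matNorm_sandwich_le : ∀ {n : ℕ} (a : Matrix (Fin n) (Fin n) ℂ) (A : Matrix (Fin n) (Fin n) V)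
    (b : Matrix (Fin n) (Fin n) ℂ),
    matNorm (sandwich a A b) ≤
      ‖Matrix.toEuclideanCLM (n := Fin n) (𝕜 := ℂ) a‖ * matNorm A *
        ‖Matrix.toEuclideanCLM (n := Fin n) (𝕜 := ℂ) b‖

open OperatorSpace (matNorm)

section matOp

variable {ι κ : Type*} [Fintype ι] [Fintype κ]
  {H : Type*} [NormedAddCommGroup H] [InnerProductSpace ℂ H]

@[simp] lemma matOp_apply (M : Matrix ι ι (H →L[ℂ] H)) (x : PiLp 2 (fun _ : ι => H)) (i : ι) :
    matOp M x i = ∑ j, M i j (x j) := by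
  simp [matOp]

lemma matOp_add (M N : Matrix ι ι (H →L[ℂ] H)) : matOp (M + N) = matOp M + matOp N := by
  ext x i
  simp [Finset.sum_add_distrib]

lemma matOp_smul (c : ℂ) (M : Matrix ι ι (H →L[ℂ] H)) : matOp (c • M) = c • matOp M := by
  ext x i
  simp [Finset.smul_sum]

lemma matOp_eq_zero {M : Matrix ι ι (H →L[ℂ] H)} (h : matOp M = 0) : M = 0 := by
  classical
  ext i j x
  have := congrArg (fun T => T (PiLp.single 2 j x) i) h
  simpa [apply_ite] using this

lemma norm_entry_le (M : Matrix ι ι (H →L[ℂ] H)) (i j : ι) : ‖M i j‖ ≤ ‖matOp M‖ := by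
  classical
  refine ContinuousLinearMap.opNorm_le_bound _ (ContinuousLinearMap.opNorm_nonneg _) fun x => ?_
  have h1 := (PiLp.norm_apply_le (matOp M (PiLp.single 2 j x)) i).trans
    ((matOp M).le_opNorm _)
  have h2 : matOp M (PiLp.single 2 j x) i = M i j x := by
    simp [apply_ite]
  rwa [h2, PiLp.norm_single] at h1

lemma norm_matOp_one (T : H →L[ℂ] H) : ‖matOp (Matrix.of fun _ _ : Fin 1 => T)‖ = ‖T‖ := by
  refine le_antisymm ?_ (norm_entry_le (Matrix.of fun _ _ : Fin 1 => T) 0 0)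
  refine ContinuousLinearMap.opNorm_le_bound _ (ContinuousLinearMap.opNorm_nonneg _) fun x => ?_
  have h : ∀ y : PiLp 2 (fun _ : Fin 1 => H), ‖y‖ = ‖y 0‖ := fun y => by
    simp [PiLp.norm_eq_of_L2, Real.sqrt_sq]
  rw [h, h, matOp_apply]
  simpa using T.le_opNorm (x 0)

lemma norm_matOp_le_sum (M : Matrix ι ι (H →L[ℂ] H)) : ‖matOp M‖ ≤ ∑ i, ∑ j, ‖M i j‖ := by
  classical
  refine ContinuousLinearMap.opNorm_le_bound _ (by positivity) fun x => ?_
  have h : matOp M x = ∑ i, PiLp.single 2 i (∑ j, M i j (x j)) := by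
    ext i
    simp [Pi.single_apply]
  rw [h, Finset.sum_mul]
  refine (norm_sum_le _ _).trans (Finset.sum_le_sum fun i _ => ?_)
  rw [PiLp.norm_single, Finset.sum_mul]
  refine (norm_sum_le _ _).trans (Finset.sum_le_sum fun j _ => ?_)
  exact ((M i j).le_opNorm _).trans
    (mul_le_mul_of_nonneg_left (PiLp.norm_apply_le x j) (norm_nonneg _))

lemma norm_matOp_reindex_le (e : ι ≃ κ) (M : Matrix ι ι (H →L[ℂ] H)) :
    ‖matOp (Matrix.reindex e e M)‖ ≤ ‖matOp M‖ := by
  refine ContinuousLinearMap.opNorm_le_bound _ (ContinuousLinearMap.opNorm_nonneg _) fun x => ?_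
  let E := LinearIsometryEquiv.piLpCongrLeft 2 ℂ H e
  have h : matOp (Matrix.reindex e e M) x = E (matOp M (E.symm x)) := by
    ext i
    simp only [E, LinearIsometryEquiv.piLpCongrLeft_symm, matOp_apply,
      LinearIsometryEquiv.piLpCongrLeft_apply, Equiv.piCongrLeft', Matrix.reindex_apply,
      Matrix.submatrix_apply]
    simp only [Equiv.coe_fn_mk, matOp_apply]
    exact Fintype.sum_equiv e.symm _ _ fun j => by
      simp [LinearIsometryEquiv.piLpCongrLeft_apply, Equiv.piCongrLeft']
  rw [h, E.norm_map]
  simpa using (matOp M).le_opNorm (E.symm x)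

lemma norm_matOp_reindex (e : ι ≃ κ) (M : Matrix ι ι (H →L[ℂ] H)) :
    ‖matOp (Matrix.reindex e e M)‖ = ‖matOp M‖ := by
  refine le_antisymm (norm_matOp_reindex_le e M) ?_
  have := norm_matOp_reindex_le e.symm (Matrix.reindex e e M)
  simpa using this

lemma norm_matOp_fromBlocks (A : Matrix ι ι (H →L[ℂ] H)) (B : Matrix κ κ (H →L[ℂ] H)) :
    ‖matOp (Matrix.fromBlocks A 0 0 B)‖ = max ‖matOp A‖ ‖matOp B‖ := by
  have hsq : ∀ x : PiLp 2 (fun _ : ι ⊕ κ => H), ‖x‖ ^ 2 =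
      ‖WithLp.toLp 2 (fun i => x (Sum.inl i))‖ ^ 2 +
        ‖WithLp.toLp 2 (fun i => x (Sum.inr i))‖ ^ 2 := fun x => by
    simp [PiLp.norm_sq_eq_of_L2]
  refine le_antisymm ?_ (max_le ?_ ?_)
  · refine ContinuousLinearMap.opNorm_le_bound _ (le_max_of_le_left (ContinuousLinearMap.opNorm_nonneg _)) fun x => ?_
    refine le_of_sq_le_sq ?_ (by positivity)
    set xa : PiLp 2 (fun _ : ι => H) := WithLp.toLp 2 (fun i => x (Sum.inl i)) with hxa
    set xb : PiLp 2 (fun _ : κ => H) := WithLp.toLp 2 (fun i => x (Sum.inr i)) with hxb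
    have ha : WithLp.toLp 2 (fun i => matOp (Matrix.fromBlocks A 0 0 B) x (Sum.inl i)) =
        matOp A xa := by
      ext i; simp [hxa]
    have hb : WithLp.toLp 2 (fun i => matOp (Matrix.fromBlocks A 0 0 B) x (Sum.inr i)) =
        matOp B xb := by
      ext i; simp [hxb]
    rw [hsq, mul_pow, hsq x, ha, hb, mul_add]
    gcongr
    · rw [← mul_pow]
      gcongr
      exact ((matOp A).le_opNorm xa).trans (by gcongr; exact le_max_left _ _)
    · rw [← mul_pow]
      gcongr
      exact ((matOp B).le_opNorm xb).trans (by gcongr; exact le_max_right _ _)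
  · refine ContinuousLinearMap.opNorm_le_bound _ (ContinuousLinearMap.opNorm_nonneg _) fun x => ?_
    let y : PiLp 2 (fun _ : ι ⊕ κ => H) := WithLp.toLp 2 (Sum.elim (fun i => x i) (fun _ => 0))
    have hy : ‖y‖ = ‖x‖ := by
      rw [← sq_eq_sq₀ (norm_nonneg _) (norm_nonneg _)]
      simp [y, PiLp.norm_sq_eq_of_L2]
    have h2 : ‖matOp A x‖ ≤ ‖matOp (Matrix.fromBlocks A 0 0 B) y‖ := by
      refine le_of_sq_le_sq ?_ (norm_nonneg _)
      simp [y, PiLp.norm_sq_eq_of_L2]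
    exact hy ▸ h2.trans ((matOp _).le_opNorm y)
  · refine ContinuousLinearMap.opNorm_le_bound _ (ContinuousLinearMap.opNorm_nonneg _) fun x => ?_
    let y : PiLp 2 (fun _ : ι ⊕ κ => H) := WithLp.toLp 2 (Sum.elim (fun _ => 0) (fun i => x i))
    have hy : ‖y‖ = ‖x‖ := by
      rw [← sq_eq_sq₀ (norm_nonneg _) (norm_nonneg _)]
      simp [y, PiLp.norm_sq_eq_of_L2]
    have h2 : ‖matOp B x‖ ≤ ‖matOp (Matrix.fromBlocks A 0 0 B) y‖ := by
      refine le_of_sq_le_sq ?_ (norm_nonneg _)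
      simp [y, PiLp.norm_sq_eq_of_L2]
    exact hy ▸ h2.trans ((matOp _).le_opNorm y)

lemma matOp_mul (M N : Matrix ι ι (H →L[ℂ] H)) : matOp (M * N) = matOp M ∘L matOp N := by
  ext x i
  simp only [ContinuousLinearMap.comp_apply, matOp_apply, Matrix.mul_apply, map_sum]
  simp only [sum_apply]
  exact Finset.sum_comm

lemma star_matOp [CompleteSpace H] (M : Matrix ι ι (H →L[ℂ] H)) :
    matOp (star M) = star (matOp M) := by
  rw [ContinuousLinearMap.star_eq_adjoint, ContinuousLinearMap.eq_adjoint_iff]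
  intro x y
  simp only [PiLp.inner_apply, matOp_apply, Matrix.star_apply, sum_inner, inner_sum,
    ContinuousLinearMap.star_eq_adjoint, ContinuousLinearMap.adjoint_inner_left]
  exact Finset.sum_comm

/-- A scalar matrix acting on `H^ι`. -/
def scalarMat (a : Matrix ι ι ℂ) : Matrix ι ι (H →L[ℂ] H) :=
  a.map (fun c => c • (1 : H →L[ℂ] H))

lemma norm_scalarMat_le [DecidableEq ι] [CompleteSpace H] (a : Matrix ι ι ℂ) :
    ‖matOp (scalarMat (H := H) a)‖ ≤ ‖Matrix.toEuclideanCLM (n := ι) (𝕜 := ℂ) a‖ := by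
  let Φ : (EuclideanSpace ℂ ι →L[ℂ] EuclideanSpace ℂ ι) →⋆ₙₐ[ℂ]
      (PiLp 2 (fun _ : ι => H) →L[ℂ] PiLp 2 (fun _ : ι => H)) :=
    { toFun := fun T => matOp (scalarMat ((Matrix.toEuclideanCLM (n := ι) (𝕜 := ℂ)).symm T))
      map_smul' := fun c T => by
        rw [map_smul]
        ext x i
        simp [scalarMat, Finset.smul_sum, smul_smul]
      map_zero' := by
        rw [map_zero]
        ext x i
        simp [scalarMat]
      map_add' := fun S T => by
        rw [map_add]
        ext x i
        simp [scalarMat, add_smul, Finset.sum_add_distrib]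
      map_mul' := fun S T => by
        rw [map_mul]
        change _ = _ ∘L _
        rw [← matOp_mul]
        congr 1
        ext i j x
        simp [scalarMat, Matrix.mul_apply, Finset.sum_smul, smul_smul, mul_comm]
      map_star' := fun T => by
        obtain ⟨t, rfl⟩ : ∃ t, Matrix.toEuclideanCLM (n := ι) (𝕜 := ℂ) t = T :=
          ⟨_, StarAlgEquiv.apply_symm_apply _ T⟩
        have ht : star (Matrix.toEuclideanCLM (n := ι) (𝕜 := ℂ) t) =
            Matrix.toEuclideanCLM (n := ι) (𝕜 := ℂ) (star t) :=
          ((Matrix.toEuclideanCLM (n := ι) (𝕜 := ℂ)).map_star' t).symm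
        rw [ht, StarAlgEquiv.symm_apply_apply, StarAlgEquiv.symm_apply_apply, ← star_matOp]
        congr 1
        ext i j x
        simp [scalarMat] }
  have h := NonUnitalStarAlgHom.norm_apply_le Φ (Matrix.toEuclideanCLM (n := ι) (𝕜 := ℂ) a)
  simpa [Φ] using h

lemma norm_matOp_sandwich_le [CompleteSpace H] {n : ℕ} (a : Matrix (Fin n) (Fin n) ℂ)
    (A : Matrix (Fin n) (Fin n) (H →L[ℂ] H)) (b : Matrix (Fin n) (Fin n) ℂ) :
    ‖matOp (sandwich a A b)‖ ≤ ‖Matrix.toEuclideanCLM (n := Fin n) (𝕜 := ℂ) a‖ * ‖matOp A‖ *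
        ‖Matrix.toEuclideanCLM (n := Fin n) (𝕜 := ℂ) b‖ := by
  have h : sandwich a A b = scalarMat a * A * scalarMat b := by
    ext i j x
    simp only [sandwich, scalarMat, Matrix.mul_apply, Matrix.map_apply, Finset.sum_mul, sum_apply]
    rw [Finset.sum_comm]
    refine Finset.sum_congr rfl fun k _ => Finset.sum_congr rfl fun l _ => ?_
    change (a i l * b k j) • A l k x = a i l • A l k (b k j • x)
    rw [map_smul, smul_smul]
  rw [h, matOp_mul, matOp_mul]
  calc _ ≤ ‖matOp (scalarMat (H := H) a) ∘L matOp A‖ * ‖matOp (scalarMat (H := H) b)‖ :=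
        ContinuousLinearMap.opNorm_comp_le _ _
    _ ≤ (‖matOp (scalarMat (H := H) a)‖ * ‖matOp A‖) * ‖matOp (scalarMat (H := H) b)‖ := by
        gcongr; exact ContinuousLinearMap.opNorm_comp_le _ _
    _ ≤ _ := by
        gcongr
        · exact norm_scalarMat_le a
        · exact norm_scalarMat_le b

end matOp

/-! ### Concrete operator spaces and the algebra `ℓ¹(G)` -/

lemma map_blockDiag {m n : ℕ} {V : Type*} {W : Type*} [Zero V] [Zero W] (f : V → W) (hf : f 0 = 0)
    (A : Matrix (Fin m) (Fin m) V) (B : Matrix (Fin n) (Fin n) V) :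
    (blockDiag A B).map f = blockDiag (A.map f) (B.map f) := by
  unfold blockDiag
  rw [Matrix.reindex_apply, Matrix.reindex_apply, ← Matrix.submatrix_map, Matrix.fromBlocks_map,
    Matrix.map_zero _ hf, Matrix.map_zero _ hf]

lemma map_sandwich {m n : ℕ} {V : Type*} {W : Type*} [AddCommGroup V] [Module ℂ V]
    [AddCommGroup W] [Module ℂ W] (φ : V →ₗ[ℂ] W) (f : V → W) (hf : ∀ x, f x = φ x)
    (a : Matrix (Fin m) (Fin n) ℂ) (A : Matrix (Fin n) (Fin n) V) (b : Matrix (Fin n) (Fin m) ℂ) :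
    (sandwich a A b).map f = sandwich a (A.map f) b := by
  obtain rfl : f = φ := funext hf
  ext i j
  simp [sandwich]

/-- A subspace of `B(H)` with the norms `M_n(X) ⊆ M_n(B(H)) = B(Hⁿ)`. -/
instance instOperatorSpaceSubmodule {H : Type v} [NormedAddCommGroup H] [InnerProductSpace ℂ H]
    [CompleteSpace H] (X : Submodule ℂ (H →L[ℂ] H)) : OperatorSpace X where
  matNorm A := ‖matOp (A.map Subtype.val)‖
  matNorm_add_le A B := by
    rw [Matrix.map_add _ (fun _ _ => rfl), matOp_add]
    exact norm_add_le _ _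
  matNorm_smul c A := by
    have h : (c • A).map Subtype.val = c • A.map (Subtype.val : X → H →L[ℂ] H) := rfl
    rw [h, matOp_smul]
    exact norm_smul _ _
  eq_zero_of_matNorm A h := by
    have := matOp_eq_zero ((ContinuousLinearMap.opNorm_zero_iff _).1 h)
    ext i j : 2
    simpa using congrFun (congrFun this i) j
  matNorm_one x := norm_matOp_one (x : H →L[ℂ] H)
  matNorm_blockDiag A B := by
    rw [map_blockDiag Subtype.val rfl, blockDiag, norm_matOp_reindex, norm_matOp_fromBlocks]
  matNorm_sandwich_le a A b := by
    rw [map_sandwich X.subtype Subtype.val (fun _ => rfl)]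
    exact norm_matOp_sandwich_le _ _ _

/-- The Banach space `ℓ¹(G)`. -/
abbrev Ell1 (G : Type u) : Type u := lp (fun _ : G => ℂ) 1

section Ell1

variable {G : Type u}

lemma Ell1.summable_norm (f : Ell1 G) : Summable fun s => ‖f s‖ := by
  simpa using f.2.summable (by simp)

lemma Ell1.norm_eq (f : Ell1 G) : ‖f‖ = ∑' s, ‖f s‖ := by
  rw [lp.norm_eq_tsum_rpow (by simp)]
  simp

/-- The pointwise product of a summable function with a bounded one. -/
def Ell1.mulBdd (f : Ell1 G) (g : G → ℂ) (C : ℝ) (hg : ∀ s, ‖g s‖ ≤ C) : Ell1 G :=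
  ⟨fun s => f s * g s, memℓp_gen (by
    simp only [norm_mul, ENNReal.toReal_one, Real.rpow_one]
    exact Summable.of_nonneg_of_le (fun s => by positivity)
      (fun s => mul_le_mul_of_nonneg_left (hg s) (norm_nonneg _)) (f.summable_norm.mul_right C))⟩

lemma Ell1.norm_mulBdd_le (f : Ell1 G) (g : G → ℂ) (C : ℝ) (hg : ∀ s, ‖g s‖ ≤ C) :
    ‖f.mulBdd g C hg‖ ≤ ‖f‖ * C := by
  rw [Ell1.norm_eq, Ell1.norm_eq, ← tsum_mul_right]
  refine Summable.tsum_le_tsum (fun s => ?_) (Ell1.summable_norm _) (f.summable_norm.mul_right C)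
  change ‖f s * g s‖ ≤ _
  rw [norm_mul]
  exact mul_le_mul_of_nonneg_left (hg s) (norm_nonneg _)

/-- The pointwise product on `ℓ¹(G)`. -/
instance : Mul (Ell1 G) :=
  ⟨fun f g => f.mulBdd g ‖g‖ (fun s => lp.norm_apply_le_norm one_ne_zero g s)⟩

@[simp] lemma Ell1.mul_apply (f g : Ell1 G) (s : G) : (f * g) s = f s * g s := rfl

instance : NonUnitalNormedRing (Ell1 G) where
  __ := lp.normedAddCommGroup (E := fun _ : G => ℂ) (p := 1)
  left_distrib f g h := by ext s; simp [mul_add]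
  right_distrib f g h := by ext s; simp [add_mul]
  zero_mul f := by ext s; simp
  mul_zero f := by ext s; simp
  mul_assoc f g h := by ext s; simp [mul_assoc]
  norm_mul_le f g := Ell1.norm_mulBdd_le _ _ _ _

/-- The sum `∑ₛ f(s) v(s)`, for `f ∈ ℓ¹(G)` and a bounded family `v` of operators. -/
def Ell1.pair {H : Type v} [NormedAddCommGroup H] [InnerProductSpace ℂ H]
    (v : G → (H →L[ℂ] H)) (f : Ell1 G) : H →L[ℂ] H :=
  ∑' s, f s • v s

/-- Families, indexed by `G`, of contractive operators on some `ℂᵐ`. -/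
abbrev ContractionFamily (G : Type u) : Type u :=
  Σ m : ℕ, {v : G → (EuclideanSpace ℂ (Fin m) →L[ℂ] EuclideanSpace ℂ (Fin m)) // ∀ s, ‖v s‖ ≤ 1}

lemma Ell1.pair_smul {H : Type v} [NormedAddCommGroup H] [InnerProductSpace ℂ H]
    {v : G → (H →L[ℂ] H)} (c : ℂ) (f : Ell1 G) : (c • f).pair v = c • f.pair v := by
  unfold Ell1.pair
  rw [← tsum_const_smul'' c]
  simp [smul_smul]

section pair

variable {H : Type v} [NormedAddCommGroup H] [InnerProductSpace ℂ H] [CompleteSpace H]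
  {v : G → (H →L[ℂ] H)} {C : ℝ}

lemma Ell1.summable_pair (hv : ∀ s, ‖v s‖ ≤ C) (f : Ell1 G) :
    Summable fun s => f s • v s := by
  refine Summable.of_norm_bounded (f.summable_norm.mul_right C) fun s => ?_
  rw [norm_smul]
  exact mul_le_mul_of_nonneg_left (hv s) (norm_nonneg _)

lemma Ell1.pair_add (hv : ∀ s, ‖v s‖ ≤ C) (f g : Ell1 G) :
    (f + g).pair v = f.pair v + g.pair v := by
  unfold Ell1.pair
  rw [← (f.summable_pair hv).tsum_add (g.summable_pair hv)]
  simp [add_smul]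

lemma Ell1.norm_pair_le (hv : ∀ s, ‖v s‖ ≤ C) (f : Ell1 G) : ‖f.pair v‖ ≤ ‖f‖ * C := by
  refine tsum_of_norm_bounded (f.norm_eq ▸ f.summable_norm.hasSum.mul_right C) fun s => ?_
  rw [norm_smul]
  exact mul_le_mul_of_nonneg_left (hv s) (norm_nonneg _)

/-- `f ↦ ∑ₛ f(s) v(s)` as a linear map. -/
def Ell1.pairₗ (v : G → (H →L[ℂ] H)) (hv : ∀ s, ‖v s‖ ≤ C) : Ell1 G →ₗ[ℂ] (H →L[ℂ] H) where
  toFun f := f.pair v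
  map_add' := Ell1.pair_add hv
  map_smul' c f := Ell1.pair_smul c f

end pair

/-- The norm of `M_n(ℓ¹(G))`, where `ℓ¹(G)` is the predual of `ℓ^∞(G)`: the supremum of
`‖∑ₛ f(s) ⊗ v(s)‖` over all `m` and all `v` in the unit ball of `ℓ^∞(G; M_m) = M_m(ℓ^∞(G))`. -/
def ell1MatNorm {n : ℕ} (A : Matrix (Fin n) (Fin n) (Ell1 G)) : ℝ :=
  ⨆ v : ContractionFamily G, ‖matOp (A.map (Ell1.pair v.2.1))‖

instance : Nonempty (ContractionFamily G) := ⟨⟨0, fun _ => 0, by simp⟩⟩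

lemma bddAbove_ell1MatNorm {n : ℕ} (A : Matrix (Fin n) (Fin n) (Ell1 G)) :
    BddAbove (Set.range fun v : ContractionFamily G => ‖matOp (A.map (Ell1.pair v.2.1))‖) := by
  refine ⟨∑ i, ∑ j, ‖A i j‖, ?_⟩
  rintro _ ⟨v, rfl⟩
  refine (norm_matOp_le_sum _).trans (Finset.sum_le_sum fun i _ => Finset.sum_le_sum fun j _ => ?_)
  simpa using Ell1.norm_pair_le v.2.2 (A i j)

lemma le_ell1MatNorm {n : ℕ} (A : Matrix (Fin n) (Fin n) (Ell1 G)) (v : ContractionFamily G) :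
    ‖matOp (A.map (Ell1.pair v.2.1))‖ ≤ ell1MatNorm A :=
  le_ciSup (bddAbove_ell1MatNorm A) v

lemma ell1MatNorm_nonneg {n : ℕ} (A : Matrix (Fin n) (Fin n) (Ell1 G)) : 0 ≤ ell1MatNorm A :=
  Real.iSup_nonneg fun _ => ContinuousLinearMap.opNorm_nonneg _

/-- The family of scalars of absolute value at most `1` given by a function. -/
def scalarFamily (g : G → ℂ) (hg : ∀ s, ‖g s‖ ≤ 1) : ContractionFamily G :=
  ⟨1, fun s => g s • 1, fun s => by
    rw [norm_smul]
    exact mul_le_one₀ (hg s) (norm_nonneg _) ContinuousLinearMap.norm_id_le⟩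

lemma pair_scalarFamily (g : G → ℂ) (hg : ∀ s, ‖g s‖ ≤ 1) (f : Ell1 G) :
    f.pair (scalarFamily g hg).2.1 = (∑' s, f s * g s) • 1 := by
  unfold Ell1.pair
  rw [← Summable.tsum_smul_const]
  · exact tsum_congr fun s => smul_smul _ _ _
  · refine Summable.of_norm_bounded f.summable_norm fun s => ?_
    rw [norm_mul]
    exact mul_le_of_le_one_right (norm_nonneg _) (hg s)

lemma norm_le_of_pair_le (f : Ell1 G) {K : ℝ}
    (h : ∀ v : ContractionFamily G, ‖f.pair v.2.1‖ ≤ K) : ‖f‖ ≤ K := by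
  have hg : ∀ s, ‖(starRingEnd ℂ (f s)) / ‖f s‖‖ ≤ 1 := fun s => by
    rw [norm_div]
    simpa using div_self_le_one _
  have h1 := h (scalarFamily _ hg)
  rw [pair_scalarFamily] at h1
  have h2 : ∀ s, f s * ((starRingEnd ℂ (f s)) / ‖f s‖) = (‖f s‖ : ℂ) := fun s => by
    rw [← mul_div_assoc, Complex.mul_conj']
    by_cases h0 : (‖f s‖ : ℂ) = 0
    · simp [h0]
    · field_simp
  simp_rw [h2] at h1
  rw [← Complex.ofReal_tsum, ← Ell1.norm_eq, norm_smul] at h1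
  have h3 : ‖(1 : EuclideanSpace ℂ (Fin 1) →L[ℂ] EuclideanSpace ℂ (Fin 1))‖ = 1 :=
    ContinuousLinearMap.norm_id
  have h4 : ‖((‖f‖ : ℝ) : ℂ)‖ = ‖f‖ := by simp
  rw [h4] at h1
  change ‖f‖ * ‖(1 : EuclideanSpace ℂ (Fin 1) →L[ℂ] EuclideanSpace ℂ (Fin 1))‖ ≤ K at h1
  rwa [h3, mul_one] at h1

instance instOperatorSpaceEll1 : OperatorSpace (Ell1 G) where
  matNorm := ell1MatNorm
  matNorm_add_le A B := ciSup_le fun v => by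
    rw [Matrix.map_add _ (Ell1.pair_add v.2.2), matOp_add]
    exact (norm_add_le _ _).trans (add_le_add (le_ell1MatNorm A v) (le_ell1MatNorm B v))
  matNorm_smul c A := by
    unfold ell1MatNorm
    rw [Real.mul_iSup_of_nonneg (norm_nonneg c)]
    congr 1
    ext v
    have h : (c • A).map (Ell1.pair v.2.1) = c • A.map (Ell1.pair v.2.1) := by
      ext1 i j
      exact Ell1.pair_smul c (A i j)
    rw [h, matOp_smul]
    exact norm_smul _ _
  eq_zero_of_matNorm A h := by
    ext1 i j
    have : ‖A i j‖ ≤ 0 := norm_le_of_pair_le _ fun v =>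
      h ▸ (norm_entry_le (A.map (Ell1.pair v.2.1)) i j).trans (le_ell1MatNorm A v)
    simpa using this
  matNorm_one f := by
    refine le_antisymm (ciSup_le fun v => ?_) (norm_le_of_pair_le _ fun v => ?_)
    · have h1 := norm_matOp_one (f.pair v.2.1)
      have h2 := Ell1.norm_pair_le v.2.2 f
      rw [mul_one] at h2
      exact h1.trans_le h2
    · have h1 := norm_matOp_one (f.pair v.2.1)
      exact h1.symm.trans_le (le_ell1MatNorm (Matrix.of fun _ _ : Fin 1 => f) v)
  matNorm_blockDiag A B := by
    have h : ∀ v : ContractionFamily G, ‖matOp ((blockDiag A B).map (Ell1.pair v.2.1))‖ =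
        max ‖matOp (A.map (Ell1.pair v.2.1))‖ ‖matOp (B.map (Ell1.pair v.2.1))‖ := fun v => by
      rw [map_blockDiag _ (by simp [Ell1.pair]), blockDiag, norm_matOp_reindex,
        norm_matOp_fromBlocks]
    refine le_antisymm (ciSup_le fun v => ?_) (max_le (ciSup_le fun v => ?_) (ciSup_le fun v => ?_))
    · rw [h]
      exact max_le_max (le_ell1MatNorm A v) (le_ell1MatNorm B v)
    · exact ((le_max_left _ _).trans (h v).ge).trans (le_ell1MatNorm _ v)
    · exact ((le_max_right _ _).trans (h v).ge).trans (le_ell1MatNorm _ v)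
  matNorm_sandwich_le a A b := ciSup_le fun v => by
    rw [map_sandwich (Ell1.pairₗ v.2.1 v.2.2) (Ell1.pair v.2.1) (fun _ => rfl)]
    refine (norm_matOp_sandwich_le _ _ _).trans ?_
    gcongr
    exact le_ell1MatNorm A v

end Ell1

/-! ### Completely bounded modules and operator projectivity -/

/-- The matrix `[b(a_ij, x_kl)]`, indexed by `(i, k)` and `(j, l)`, for a map `b` of two variables. -/
def ampl {p q : ℕ} {U : Type*} {V : Type*} {W : Type*} (b : U → V → W)
    (a : Matrix (Fin p) (Fin p) U) (x : Matrix (Fin q) (Fin q) V) :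
    Matrix (Fin (p * q)) (Fin (p * q)) W :=
  Matrix.reindex finProdFinEquiv finProdFinEquiv (Matrix.kroneckerMap b a x)

/-- Completely bounded linear maps: `sup_n ‖φ_n‖ < ∞`. -/
def IsCompletelyBounded {V : Type v} {W : Type w} [NormedAddCommGroup V] [NormedSpace ℂ V]
    [OperatorSpace V] [NormedAddCommGroup W] [NormedSpace ℂ W] [OperatorSpace W]
    (φ : V →ₗ[ℂ] W) : Prop :=
  ∃ C : ℝ, ∀ (n : ℕ) (A : Matrix (Fin n) (Fin n) V), matNorm (A.map φ) ≤ C * matNorm A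

/-- A completely contractive Banach algebra: a Banach algebra with an operator space structure such
that the multiplication is a complete contraction on the operator space projective tensor product,
that is, `‖[a_ij b_kl]‖ ≤ ‖[a_ij]‖ ‖[b_kl]‖` for all matrices. -/
class CCBanachAlgebra (A : Type w) [NonUnitalNormedRing A] [NormedSpace ℂ A]
    [OperatorSpace A] : Prop where
  complete : CompleteSpace A
  scalarTower : IsScalarTower ℂ A A
  smulComm : SMulCommClass ℂ A A
  matNorm_mul_le : ∀ (p q : ℕ) (a : Matrix (Fin p) (Fin p) A) (b : Matrix (Fin q) (Fin q) A),
    matNorm (ampl (· * ·) a b) ≤ matNorm a * matNorm b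

/-- A completely bounded left `A`-module: a complete operator space with a left action of `A` which
is completely bounded on the operator space projective tensor product `A ⊗̂ X`, that is,
`‖[a_ij · x_kl]‖ ≤ C ‖[a_ij]‖ ‖[x_kl]‖` for all matrices. -/
structure CBModule (A : Type w) [NonUnitalNormedRing A] [NormedSpace ℂ A] [OperatorSpace A]
    [CCBanachAlgebra A] where
  carrier : Type v
  [normedAddCommGroup : NormedAddCommGroup carrier]
  [normedSpace : NormedSpace ℂ carrier]
  [completeSpace : CompleteSpace carrier]
  [operatorSpace : OperatorSpace carrier]
  act : A →ₗ[ℂ] carrier →ₗ[ℂ] carrier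
  act_mul : ∀ (a b : A) (x : carrier), act (a * b) x = act a (act b x)
  act_cb : ∃ C : ℝ, ∀ (p q : ℕ) (a : Matrix (Fin p) (Fin p) A) (x : Matrix (Fin q) (Fin q) carrier),
    matNorm (ampl (fun a x => act a x) a x) ≤ C * matNorm a * matNorm x

attribute [instance] CBModule.normedAddCommGroup CBModule.normedSpace CBModule.completeSpace
  CBModule.operatorSpace

section projective

variable {A : Type w} [NonUnitalNormedRing A] [NormedSpace ℂ A] [OperatorSpace A]
  [CCBanachAlgebra A]

/-- Completely bounded left `A`-module maps. -/
def IsCBModuleMap {X Y : CBModule.{v, w} A} (φ : X.carrier →ₗ[ℂ] Y.carrier) : Prop :=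
  IsCompletelyBounded φ ∧ ∀ (a : A) (x : X.carrier), φ (X.act a x) = Y.act a (φ x)

/-- A subspace which is the range of a completely bounded projection. -/
def IsCompletelyComplemented {V : Type v} [NormedAddCommGroup V] [NormedSpace ℂ V]
    [OperatorSpace V] (W : Submodule ℂ V) : Prop :=
  ∃ P : V →ₗ[ℂ] V, IsCompletelyBounded P ∧ (∀ x, P x ∈ W) ∧ ∀ x ∈ W, P x = x

/-- Admissible maps: the kernel is completely complemented, and the range is closed and completely
complemented. -/
def IsAdmissible {V : Type v} {W : Type v} [NormedAddCommGroup V] [NormedSpace ℂ V]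
    [OperatorSpace V] [NormedAddCommGroup W] [NormedSpace ℂ W] [OperatorSpace W]
    (φ : V →ₗ[ℂ] W) : Prop :=
  IsCompletelyComplemented (LinearMap.ker φ) ∧
    IsClosed (LinearMap.range φ : Set W) ∧ IsCompletelyComplemented (LinearMap.range φ)

/-- `X` is operator projective in `A`-mod: every completely bounded module map `S : X → F` lifts
through every admissible surjective completely bounded module map `T : E → F`. -/
def IsOperatorProjective (X : CBModule.{v, w} A) : Prop :=
  ∀ (E F : CBModule.{v, w} A) (T : E.carrier →ₗ[ℂ] F.carrier), IsCBModuleMap T →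
    IsAdmissible T → Function.Surjective T →
    ∀ S : X.carrier →ₗ[ℂ] F.carrier, IsCBModuleMap S →
      ∃ R : X.carrier →ₗ[ℂ] E.carrier, IsCBModuleMap R ∧ T ∘ₗ R = S

/-- The variant of operator projectivity in which only those `T : E → F` are considered which have a
completely bounded linear right inverse (such `T` are admissible and surjective). -/
def IsRelativelyOperatorProjective (X : CBModule.{v, w} A) : Prop :=
  ∀ (E F : CBModule.{v, w} A) (T : E.carrier →ₗ[ℂ] F.carrier), IsCBModuleMap T →
    (∃ σ : F.carrier →ₗ[ℂ] E.carrier, IsCompletelyBounded σ ∧ T ∘ₗ σ = LinearMap.id) →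
    ∀ S : X.carrier →ₗ[ℂ] F.carrier, IsCBModuleMap S →
      ∃ R : X.carrier →ₗ[ℂ] E.carrier, IsCBModuleMap R ∧ T ∘ₗ R = S

end projective

/-! ### Norm estimates for the action of `ℓ¹(G)` -/

section estimates

variable {G : Type u} {K : Type v} [NormedAddCommGroup K] [InnerProductSpace ℂ K]

lemma norm_vectorState_le {q : ℕ} (ξ η : K) (hξ : ‖ξ‖ ≤ 1) (hη : ‖η‖ ≤ 1)
    (T : Matrix (Fin q) (Fin q) (K →L[ℂ] K)) :
    ‖Matrix.toEuclideanCLM (n := Fin q) (𝕜 := ℂ) (T.map fun S => ⟪η, S ξ⟫_ℂ)‖ ≤ ‖matOp T‖ := by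
  refine ContinuousLinearMap.opNorm_le_bound _ (ContinuousLinearMap.opNorm_nonneg _) fun x => ?_
  let X : PiLp 2 (fun _ : Fin q => K) := WithLp.toLp 2 fun l => x l • ξ
  have hX : ‖X‖ ≤ ‖x‖ := by
    refine le_of_sq_le_sq ?_ (norm_nonneg _)
    rw [PiLp.norm_sq_eq_of_L2, EuclideanSpace.norm_sq_eq]
    refine Finset.sum_le_sum fun i _ => ?_
    simp only [X, norm_smul]
    gcongr
    exact mul_le_of_le_one_right (norm_nonneg _) hξ
  refine le_trans ?_ (((matOp T).le_opNorm X).trans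
    (mul_le_mul_of_nonneg_left hX (ContinuousLinearMap.opNorm_nonneg _)))
  refine le_of_sq_le_sq ?_ (norm_nonneg _)
  rw [EuclideanSpace.norm_sq_eq, PiLp.norm_sq_eq_of_L2]
  refine Finset.sum_le_sum fun k _ => ?_
  have h : (Matrix.toEuclideanCLM (n := Fin q) (𝕜 := ℂ) (T.map fun S => ⟪η, S ξ⟫_ℂ) x) k =
      ⟪η, matOp T X k⟫_ℂ := by
    rw [Matrix.ofLp_toEuclideanCLM, matOp_apply, inner_sum]
    simp [Matrix.mulVec, dotProduct, X, inner_smul_right, mul_comm]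
  rw [h]
  gcongr
  exact (norm_inner_le_norm _ _).trans (mul_le_of_le_one_left (norm_nonneg _) hη)

lemma norm_matOp_prod_le {ι κ : Type*} [Fintype ι] [Fintype κ]
    (M : Matrix (ι × κ) (ι × κ) (K →L[ℂ] K)) :
    ‖matOp M‖ ≤ ‖matOp (H := PiLp 2 (fun _ : κ => K))
      (Matrix.of fun i j => matOp (Matrix.of fun k l => M (i, k) (j, l)))‖ := by
  refine ContinuousLinearMap.opNorm_le_bound _ (ContinuousLinearMap.opNorm_nonneg _) fun x => ?_
  let Z (x : PiLp 2 (fun _ : ι × κ => K)) : PiLp 2 (fun _ : ι => PiLp 2 (fun _ : κ => K)) :=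
    WithLp.toLp 2 fun i => WithLp.toLp 2 fun k => x (i, k)
  have hZ : ∀ x, ‖Z x‖ = ‖x‖ := fun x => by
    rw [← sq_eq_sq₀ (norm_nonneg _) (norm_nonneg _)]
    simp [Z, PiLp.norm_sq_eq_of_L2, Fintype.sum_prod_type]
  have h : Z (matOp M x) = matOp (H := PiLp 2 (fun _ : κ => K))
      (Matrix.of fun i j => matOp (Matrix.of fun k l => M (i, k) (j, l))) (Z x) := by
    ext i k
    simp [Z, Fintype.sum_prod_type]
  rw [← hZ, ← hZ x, h]
  exact ContinuousLinearMap.le_opNorm _ _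

lemma inner_matOp_pair {n : ℕ} {w : G → (K →L[ℂ] K)} [CompleteSpace K] {C : ℝ}
    (hw : ∀ s, ‖w s‖ ≤ C) (A : Matrix (Fin n) (Fin n) (Ell1 G)) (x y : PiLp 2 (fun _ : Fin n => K)) :
    ⟪y, matOp (A.map (Ell1.pair w)) x⟫_ℂ = ∑ i, ∑ j, ∑' s, A i j s * ⟪y i, w s (x j)⟫_ℂ := by
  simp only [PiLp.inner_apply, matOp_apply, inner_sum, Matrix.map_apply]
  refine Finset.sum_congr rfl fun i _ => Finset.sum_congr rfl fun j _ => ?_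
  let L : (K →L[ℂ] K) →L[ℂ] ℂ := innerSL ℂ (y i) ∘L ContinuousLinearMap.apply ℂ K (x j)
  have h := L.map_tsum (Ell1.summable_pair hw (A i j))
  simpa [L, Ell1.pair] using! h

lemma norm_matOp_pair_le_one [CompleteSpace K] {n : ℕ} {w : G → (K →L[ℂ] K)}
    (hw : ∀ s, ‖w s‖ ≤ 1) (A : Matrix (Fin n) (Fin n) (Ell1 G)) :
    ‖matOp (A.map (Ell1.pair w))‖ ≤ ell1MatNorm A := by
  refine ContinuousLinearMap.opNorm_le_bound _ (ell1MatNorm_nonneg A) fun x => ?_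
  have key : ∀ y : PiLp 2 (fun _ : Fin n => K),
      ‖⟪y, matOp (A.map (Ell1.pair w)) x⟫_ℂ‖ ≤ ‖y‖ * (ell1MatNorm A * ‖x‖) := fun y => by
    let W : Submodule ℂ K := Submodule.span ℂ (Set.range x ∪ Set.range y)
    have : FiniteDimensional ℂ W :=
      FiniteDimensional.span_of_finite ℂ ((Set.finite_range _).union (Set.finite_range _))
    let J : EuclideanSpace ℂ (Fin (Module.finrank ℂ W)) →ₗᵢ[ℂ] K :=
      W.subtypeₗᵢ.comp (stdOrthonormalBasis ℂ W).repr.symm.toLinearIsometry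
    have hJ : ∀ z ∈ W, ∃ z', J z' = z := fun z hz =>
      ⟨(stdOrthonormalBasis ℂ W).repr ⟨z, hz⟩, by simp [J]⟩
    choose x' hx' using fun i => hJ (x i) (Submodule.subset_span (Or.inl ⟨i, rfl⟩))
    choose y' hy' using fun i => hJ (y i) (Submodule.subset_span (Or.inr ⟨i, rfl⟩))
    have hnx : ‖(WithLp.toLp 2 x' : PiLp 2 fun _ => _)‖ = ‖x‖ := by
      rw [← sq_eq_sq₀ (norm_nonneg _) (norm_nonneg _)]
      simp [PiLp.norm_sq_eq_of_L2, ← hx']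
    have hny : ‖(WithLp.toLp 2 y' : PiLp 2 fun _ => _)‖ = ‖y‖ := by
      rw [← sq_eq_sq₀ (norm_nonneg _) (norm_nonneg _)]
      simp [PiLp.norm_sq_eq_of_L2, ← hy']
    have hv : ∀ s, ‖ContinuousLinearMap.adjoint J.toContinuousLinearMap ∘L
        (w s ∘L J.toContinuousLinearMap)‖ ≤ 1 := fun s => by
      have h1 : ‖J.toContinuousLinearMap‖ ≤ 1 := J.norm_toContinuousLinearMap_le
      have h2 : ‖ContinuousLinearMap.adjoint J.toContinuousLinearMap‖ ≤ 1 := by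
        rwa [LinearIsometryEquiv.norm_map]
      refine (ContinuousLinearMap.opNorm_comp_le _ _).trans (mul_le_one₀ h2
        (ContinuousLinearMap.opNorm_nonneg _) ?_)
      exact (ContinuousLinearMap.opNorm_comp_le _ _).trans (mul_le_one₀ (hw s)
        (ContinuousLinearMap.opNorm_nonneg _) h1)
    have heq : ⟪y, matOp (A.map (Ell1.pair w)) x⟫_ℂ =
        ⟪(WithLp.toLp 2 y' : PiLp 2 fun _ => _), matOp (A.map (Ell1.pair fun s =>
          ContinuousLinearMap.adjoint J.toContinuousLinearMap ∘L
            (w s ∘L J.toContinuousLinearMap))) (WithLp.toLp 2 x')⟫_ℂ := by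
      rw [inner_matOp_pair hw, inner_matOp_pair hv]
      simp [ContinuousLinearMap.adjoint_inner_right, hx', hy']
    rw [heq, ← hnx, ← hny]
    refine (norm_inner_le_norm _ _).trans (mul_le_mul_of_nonneg_left ?_ (norm_nonneg _))
    refine (ContinuousLinearMap.le_opNorm _ _).trans ?_
    gcongr
    exact le_ell1MatNorm A ⟨_, _, hv⟩
  by_cases h0 : ‖matOp (A.map (Ell1.pair w)) x‖ = 0
  · rw [h0]
    exact mul_nonneg (ell1MatNorm_nonneg A) (norm_nonneg _)
  · have h := key (matOp (A.map (Ell1.pair w)) x)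
    rw [inner_self_eq_norm_sq_to_K, norm_pow, sq] at h
    simp only [RCLike.norm_ofReal, abs_norm] at h
    exact le_of_mul_le_mul_left h (lt_of_le_of_ne (norm_nonneg _) (Ne.symm h0))

lemma norm_matOp_pair_le [CompleteSpace K] {n : ℕ} {w : G → (K →L[ℂ] K)} {C : ℝ} (hC : 0 ≤ C)
    (hw : ∀ s, ‖w s‖ ≤ C) (A : Matrix (Fin n) (Fin n) (Ell1 G)) :
    ‖matOp (A.map (Ell1.pair w))‖ ≤ ell1MatNorm A * C := by
  have h1 : ∀ s, ‖((C : ℂ)⁻¹) • w s‖ ≤ 1 := fun s => by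
    rw [norm_smul, norm_inv, Complex.norm_real, Real.norm_of_nonneg hC]
    exact (mul_le_mul_of_nonneg_left (hw s) (by positivity)).trans (inv_mul_le_one)
  have h2 : A.map (Ell1.pair w) = (C : ℂ) • A.map (Ell1.pair fun s => ((C : ℂ)⁻¹) • w s) := by
    ext1 i j
    simp only [Matrix.map_apply, Matrix.smul_apply, Ell1.pair]
    rw [← tsum_const_smul'' (C : ℂ)]
    refine tsum_congr fun s => ?_
    by_cases h0 : (C : ℂ) = 0
    · have : w s = 0 := by
        have := hw s
        rw [Complex.ofReal_eq_zero.1 h0] at this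
        exact (ContinuousLinearMap.opNorm_zero_iff _).1
          (le_antisymm this (ContinuousLinearMap.opNorm_nonneg _))
      simp [this]
    · rw [smul_comm (C : ℂ), smul_smul (C : ℂ), mul_inv_cancel₀ h0, one_smul]
  rw [h2, matOp_smul, norm_smul, Complex.norm_real, Real.norm_of_nonneg hC, mul_comm]
  gcongr
  exact norm_matOp_pair_le_one h1 A

lemma norm_matOp_ampl_le [CompleteSpace K] {p q : ℕ} {V : Type*} {u : G → (K →L[ℂ] K)}
    (hu : ∀ s, ‖u s‖ ≤ 1) (c : G → V → ℂ) (x : Matrix (Fin q) (Fin q) V) {C : ℝ} (hC : 0 ≤ C)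
    (hc : ∀ s, ‖Matrix.toEuclideanCLM (n := Fin q) (𝕜 := ℂ) (x.map (c s))‖ ≤ C)
    (A : Matrix (Fin p) (Fin p) (Ell1 G)) :
    ‖matOp (ampl (fun f y => Ell1.pair (fun s => c s y • u s) f) A x)‖ ≤ ell1MatNorm A * C := by
  let W : G → (PiLp 2 (fun _ : Fin q => K) →L[ℂ] PiLp 2 (fun _ : Fin q => K)) :=
    fun s => matOp (x.map fun y => c s y • u s)
  have hW : ∀ s, ‖W s‖ ≤ C := fun s => by
    have h : x.map (fun y => c s y • u s) =
        scalarMat (x.map (c s)) * Matrix.diagonal fun _ => u s := by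
      ext1 i j
      simp [scalarMat]
    have h1 : ‖matOp (Matrix.diagonal fun _ : Fin q => u s)‖ ≤ 1 := by
      refine ContinuousLinearMap.opNorm_le_bound _ zero_le_one fun z => ?_
      rw [one_mul]
      refine le_of_sq_le_sq ?_ (norm_nonneg _)
      rw [PiLp.norm_sq_eq_of_L2, PiLp.norm_sq_eq_of_L2]
      refine Finset.sum_le_sum fun i _ => ?_
      gcongr
      have h3 : matOp (Matrix.diagonal fun _ : Fin q => u s) z i = u s (z i) := by
        rw [matOp_apply, Finset.sum_eq_single i]
        · simp
        · intro j _ hj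
          simp [Matrix.diagonal_apply_ne' _ hj]
        · simp
      rw [h3]
      exact ((u s).le_opNorm _).trans (mul_le_of_le_one_left (norm_nonneg _) (hu s))
    simp only [W]
    rw [h, matOp_mul]
    exact (ContinuousLinearMap.opNorm_comp_le _ _).trans
      ((mul_le_of_le_one_right (ContinuousLinearMap.opNorm_nonneg _) h1).trans
        ((norm_scalarMat_le _).trans (hc s)))
  have hsum : ∀ k l, ∀ s, ‖c s (x k l) • u s‖ ≤ C := fun k l s =>
    (norm_entry_le (x.map fun y => c s y • u s) k l).trans (hW s)
  rw [ampl, norm_matOp_reindex]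
  refine (norm_matOp_prod_le _).trans ?_
  refine le_trans (le_of_eq ?_) (norm_matOp_pair_le hC hW A)
  congr 2
  ext i j z k
  let L : (PiLp 2 (fun _ : Fin q => K) →L[ℂ] PiLp 2 (fun _ : Fin q => K)) →L[ℂ] K :=
    PiLp.proj 2 (fun _ : Fin q => K) k ∘L ContinuousLinearMap.apply ℂ _ z
  have h1 := L.map_tsum (Ell1.summable_pair hW (A i j))
  have h2 : ∀ l, (∑' s, A i j s • (c s (x k l) • u s)) (z l) =
      ∑' s, A i j s • (c s (x k l) • u s) (z l) := fun l =>
    (ContinuousLinearMap.apply ℂ K (z l)).map_tsum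
      (Ell1.summable_pair (v := fun s => c s (x k l) • u s) (hsum k l) (A i j))
  have h3 : ∀ l, Summable fun s => A i j s • (c s (x k l) • u s) (z l) := fun l =>
    (Ell1.summable_pair (v := fun s => c s (x k l) • u s) (hsum k l) (A i j)).mapL
      (ContinuousLinearMap.apply ℂ K (z l))
  simp only [Matrix.of_apply, matOp_apply, Matrix.kroneckerMap_apply, Matrix.map_apply, Ell1.pair]
  simp only [h2]
  rw [← Summable.tsum_finsetSum fun l _ => h3 l]
  refine Eq.trans (tsum_congr fun s => ?_) h1.symm
  simp [L, W, Finset.smul_sum]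

end estimates

lemma norm_evalMat_le {G : Type u} {q : ℕ} (b : Matrix (Fin q) (Fin q) (Ell1 G)) (s : G) :
    ‖Matrix.toEuclideanCLM (n := Fin q) (𝕜 := ℂ) (b.map fun g => g s)‖ ≤ ell1MatNorm b := by
  classical
  let w : G → (EuclideanSpace ℂ (Fin 1) →L[ℂ] EuclideanSpace ℂ (Fin 1)) :=
    fun t => if t = s then ContinuousLinearMap.id ℂ _ else 0
  have hw : ∀ t, ‖w t‖ ≤ 1 := fun t => by
    by_cases ht : t = s
    · simp only [w, if_pos ht]
      exact ContinuousLinearMap.norm_id_le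
    · simp [w, if_neg ht]
  let e : EuclideanSpace ℂ (Fin 1) := EuclideanSpace.single 0 1
  have he : ‖e‖ = 1 := by simp [e]
  have h2 : b.map (fun g : Ell1 G => g s) = (b.map (Ell1.pair w)).map fun S => ⟪e, S e⟫_ℂ := by
    ext i j
    simp only [Matrix.map_apply]
    have h3 : (b i j).pair w = b i j s • ContinuousLinearMap.id ℂ (EuclideanSpace ℂ (Fin 1)) := by
      unfold Ell1.pair
      rw [tsum_eq_single s (fun t ht => by simp [w, if_neg ht])]
      simp [w]
    rw [h3]
    change _ = ⟪e, b i j s • e⟫_ℂ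
    rw [inner_smul_right, inner_self_eq_norm_sq_to_K, he]
    simp
  rw [h2]
  exact (norm_vectorState_le e e he.le he.le _).trans (le_ell1MatNorm b ⟨1, w, hw⟩)

/-- `ℓ¹(G)` with the pointwise product is a completely contractive Banach algebra. -/
instance instCCBanachAlgebraEll1 {G : Type u} : CCBanachAlgebra (Ell1 G) where
  complete := inferInstance
  scalarTower := ⟨fun c f g => by ext s; simp [mul_assoc]⟩
  smulComm := ⟨fun c f g => by ext s; simp [mul_left_comm]⟩
  matNorm_mul_le p q a b := ciSup_le fun v => by
    obtain ⟨m, v, hv⟩ := v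
    have h : (ampl (· * ·) a b).map (Ell1.pair v) =
        ampl (fun (f g : Ell1 G) => Ell1.pair (fun s => g s • v s) f) a b := by
      ext1 i j
      exact tsum_congr fun s => mul_smul _ _ _
    have h1 := norm_matOp_ampl_le hv (fun s (g : Ell1 G) => g s) b (ell1MatNorm_nonneg b)
      (norm_evalMat_le b) a
    rw [← h] at h1
    exact h1

/-! ### Unitary representations and the modules they carry -/

section representations

variable {G : Type u} [Group G] {K : Type v} [NormedAddCommGroup K] [InnerProductSpace ℂ K]

/-- The unitary operator `π(s)`. -/
def repOp (π : G →* (K ≃ₗᵢ[ℂ] K)) (s : G) : K →L[ℂ] K :=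
  (π s).toLinearIsometry.toContinuousLinearMap

/-- The integrated form `π(f) = ∑ₛ f(s) π(s)` of a unitary representation. -/
def integratedForm (π : G →* (K ≃ₗᵢ[ℂ] K)) (f : Ell1 G) : K →L[ℂ] K :=
  ∑' s, f s • repOp π s

/-- For a vector `ξ` whose orbit is orthonormal, the functional `T ↦ ⟨T ξ, π(s) ξ⟩` reads off the
coefficient at `s` of `T = π(g)`. Multiplying the coefficients of `T` by `f ∈ ℓ¹(G)` gives
`f · T = ∑ₛ f(s) ⟨T ξ, π(s) ξ⟩ π(s)`. -/
def coeffMul (π : G →* (K ≃ₗᵢ[ℂ] K)) (ξ : K) (f : Ell1 G) (T : K →L[ℂ] K) : K →L[ℂ] K :=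
  ∑' s, (f s * ⟪repOp π s ξ, T ξ⟫_ℂ) • repOp π s

variable (π : G →* (K ≃ₗᵢ[ℂ] K)) {ξ : K}

lemma norm_repOp_le (s : G) : ‖repOp π s‖ ≤ 1 :=
  (π s).toLinearIsometry.norm_toContinuousLinearMap_le

lemma coeffMul_eq_pair (f : Ell1 G) (T : K →L[ℂ] K) :
    coeffMul π ξ f T = f.pair (fun s => ⟪repOp π s ξ, T ξ⟫_ℂ • repOp π s) :=
  tsum_congr fun s => mul_smul _ _ _

lemma norm_coeff_le (hξ : Orthonormal ℂ fun s => repOp π s ξ) (T : K →L[ℂ] K) (s : G) :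
    ‖⟪repOp π s ξ, T ξ⟫_ℂ‖ ≤ ‖T‖ := by
  have h1 : ‖ξ‖ = 1 := by simpa [repOp] using hξ.1 1
  refine (norm_inner_le_norm _ _).trans ?_
  have h2 : ‖repOp π s ξ‖ = 1 := hξ.1 s
  rw [h2, one_mul]
  simpa [h1] using T.le_opNorm ξ

lemma norm_coeff_smul_le (hξ : Orthonormal ℂ fun s => repOp π s ξ) (T : K →L[ℂ] K) (s : G) :
    ‖⟪repOp π s ξ, T ξ⟫_ℂ • repOp π s‖ ≤ ‖T‖ := by
  rw [norm_smul]
  exact (mul_le_of_le_one_right (norm_nonneg _) (norm_repOp_le π s)).trans (norm_coeff_le π hξ T s)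

lemma coeffMul_eq_integratedForm (hξ : Orthonormal ℂ fun s => repOp π s ξ) (f : Ell1 G)
    (T : K →L[ℂ] K) : coeffMul π ξ f T =
      integratedForm π (f.mulBdd (fun s => ⟪repOp π s ξ, T ξ⟫_ℂ) ‖T‖ (norm_coeff_le π hξ T)) :=
  rfl

variable [CompleteSpace K]

lemma coeff_integratedForm (hξ : Orthonormal ℂ fun s => repOp π s ξ) (g : Ell1 G) (s : G) :
    ⟪repOp π s ξ, integratedForm π g ξ⟫_ℂ = g s := by
  classical
  let L : (K →L[ℂ] K) →L[ℂ] ℂ := innerSL ℂ (repOp π s ξ) ∘L ContinuousLinearMap.apply ℂ K ξ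
  have h : L (integratedForm π g) = ∑' t, L (g t • repOp π t) :=
    L.map_tsum (Ell1.summable_pair (norm_repOp_le π) g)
  have h2 : ∀ t, L (g t • repOp π t) = g t * (if s = t then 1 else 0) := fun t => by
    have := orthonormal_iff_ite.1 hξ s t
    simp [L, this]
  have h1 : L (integratedForm π g) = g s := by
    rw [h]
    simp only [h2]
    rw [tsum_eq_single s (fun t ht => by simp [Ne.symm ht])]
    simp
  exact h1

/-- `f · π(g) = π(f g)` for `f, g ∈ ℓ¹(G)`. -/
lemma coeffMul_integratedForm (hξ : Orthonormal ℂ fun s => repOp π s ξ) (f g : Ell1 G) :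
    coeffMul π ξ f (integratedForm π g) = integratedForm π (f * g) := by
  refine tsum_congr fun s => ?_
  rw [coeff_integratedForm π hξ, Ell1.mul_apply]

/-- The coefficients of `f · T` are those of `T` multiplied by `f`. -/
lemma coeff_coeffMul (hξ : Orthonormal ℂ fun s => repOp π s ξ) (f : Ell1 G) (T : K →L[ℂ] K)
    (s : G) : ⟪repOp π s ξ, coeffMul π ξ f T ξ⟫_ℂ = f s * ⟪repOp π s ξ, T ξ⟫_ℂ := by
  rw [coeffMul_eq_integratedForm π hξ, coeff_integratedForm π hξ]
  rfl

lemma norm_matOp_coeffMul_le (hξ : Orthonormal ℂ fun s => repOp π s ξ)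
    (X : Submodule ℂ (K →L[ℂ] K)) {p q : ℕ} (a : Matrix (Fin p) (Fin p) (Ell1 G))
    (x : Matrix (Fin q) (Fin q) X) :
    ‖matOp (ampl (fun f (T : X) => coeffMul π ξ f T) a x)‖ ≤
      ell1MatNorm a * ‖matOp (x.map Subtype.val)‖ := by
  have h1 : ‖ξ‖ = 1 := by simpa [repOp] using hξ.1 1
  have h2 : ∀ s, ‖repOp π s ξ‖ = 1 := hξ.1
  have h3 := norm_matOp_ampl_le (norm_repOp_le π)
    (fun s (T : X) => ⟪repOp π s ξ, (T : K →L[ℂ] K) ξ⟫_ℂ) x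
    (ContinuousLinearMap.opNorm_nonneg (matOp (x.map Subtype.val)))
    (fun s => norm_vectorState_le ξ (repOp π s ξ) h1.le (h2 s).le (x.map Subtype.val)) a
  have h4 : (fun f (T : X) => coeffMul π ξ f T) = fun f (T : X) =>
      f.pair (fun s => ⟪repOp π s ξ, (T : K →L[ℂ] K) ξ⟫_ℂ • repOp π s) := by
    funext f T
    exact coeffMul_eq_pair π f _
  rw [h4]
  exact h3

/-- A closed subspace `X` of `B(K)` which is stable under the action `(f, T) ↦ f · T` of `ℓ¹(G)`, as
a completely bounded left `ℓ¹(G)`-module. -/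
def repModule (hξ : Orthonormal ℂ fun s => repOp π s ξ) (X : Submodule ℂ (K →L[ℂ] K))
    (hX : IsClosed (X : Set (K →L[ℂ] K))) (hstab : ∀ f, ∀ T ∈ X, coeffMul π ξ f T ∈ X) :
    CBModule.{v, u} (Ell1 G) where
  carrier := X
  completeSpace := hX.completeSpace_coe
  act := LinearMap.mk₂ ℂ (fun f T => ⟨coeffMul π ξ f T, hstab f T T.2⟩)
    (fun f g T => Subtype.ext (by
      simp only [coeffMul_eq_pair, Submodule.coe_add]
      exact Ell1.pair_add (norm_coeff_smul_le π hξ T) f g))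
    (fun c f T => Subtype.ext (by
      simp only [coeffMul_eq_pair, Submodule.coe_smul]
      exact Ell1.pair_smul c f))
    (fun f S T => Subtype.ext (by
      simp only [coeffMul_eq_pair, Submodule.coe_add, Ell1.pair]
      rw [← (Ell1.summable_pair (norm_coeff_smul_le π hξ S.1) f).tsum_add
        (Ell1.summable_pair (norm_coeff_smul_le π hξ T.1) f)]
      exact tsum_congr fun s => by simp [add_smul]))
    (fun c f T => Subtype.ext (by
      simp only [coeffMul_eq_pair, Submodule.coe_smul, Ell1.pair]
      rw [← tsum_const_smul'' c]
      exact tsum_congr fun s => by simp [smul_smul, mul_left_comm]))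
  act_mul f g T := Subtype.ext (by
    refine tsum_congr fun s => ?_
    change _ = (f s * ⟪repOp π s ξ, coeffMul π ξ g T ξ⟫_ℂ) • _
    rw [coeff_coeffMul π hξ, Ell1.mul_apply, mul_assoc])
  act_cb := ⟨1, fun p q a x => by
    rw [one_mul]
    exact norm_matOp_coeffMul_le π hξ X a x⟩

end representations

/-! ### `VN(G)` and `C*(G)` for a discrete group `G` -/

section group

/-- The Hilbert space `ℓ²(G)`. -/
abbrev Ell2 (G : Type u) : Type u := lp (fun _ : G => ℂ) 2

variable (G : Type u) [Group G]

/-- The coordinatewise action of a family of unitary operators on a Hilbert space direct sum. -/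
def lpMap {ι : Type*} {E : ι → Type*} [∀ i, NormedAddCommGroup (E i)]
    [∀ i, InnerProductSpace ℂ (E i)] (φ : ∀ i, E i ≃ₗᵢ[ℂ] E i) : lp E 2 ≃ₗᵢ[ℂ] lp E 2 where
  toFun x := ⟨fun i => φ i (x i), memℓp_gen (by simpa using (lp.memℓp x).summable (by simp))⟩
  invFun x := ⟨fun i => (φ i).symm (x i),
    memℓp_gen (by simpa using (lp.memℓp x).summable (by simp))⟩
  map_add' x y := by ext i : 2; exact map_add (φ i) (x i) (y i)
  map_smul' c x := by ext i : 2; simp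
  left_inv x := by ext i : 2; simp
  right_inv x := by ext i : 2; simp
  norm_map' x := by
    simp [lp.norm_eq_tsum_rpow (p := 2) (by simp)]

@[simp] lemma lpMap_apply {ι : Type*} {E : ι → Type*} [∀ i, NormedAddCommGroup (E i)]
    [∀ i, InnerProductSpace ℂ (E i)] (φ : ∀ i, E i ≃ₗᵢ[ℂ] E i) (x : lp E 2) (i : ι) :
    lpMap φ x i = φ i (x i) := rfl

/-- The unitary operator `(U f)(x) = f(σ⁻¹ x)` on `ℓ²` given by a permutation `σ`. -/
def permUnitary {ι : Type*} (σ : Equiv.Perm ι) : 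
    lp (fun _ : ι => ℂ) 2 ≃ₗᵢ[ℂ] lp (fun _ : ι => ℂ) 2 where
  toFun f := ⟨fun x => f (σ.symm x), memℓp_gen
    ((Equiv.summable_iff σ.symm).2 ((lp.memℓp f).summable (by simp)))⟩
  invFun f := ⟨fun x => f (σ x), memℓp_gen
    ((Equiv.summable_iff σ).2 ((lp.memℓp f).summable (by simp)))⟩
  map_add' x y := by ext i : 2; rfl
  map_smul' c x := by ext i : 2; simp
  left_inv x := by ext i : 2; simp
  right_inv x := by ext i : 2; simp
  norm_map' x := by
    rw [lp.norm_eq_tsum_rpow (p := 2) (by simp), lp.norm_eq_tsum_rpow (p := 2) (by simp)]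
    congr 1
    exact Equiv.tsum_eq σ.symm fun i => ‖x i‖ ^ (2 : ENNReal).toReal

/-- The left regular representation `(λ(y) f)(x) = f(y⁻¹ x)` on `ℓ²(G)`. -/
def leftRegular : G →* (Ell2 G ≃ₗᵢ[ℂ] Ell2 G) where
  toFun y := permUnitary (Equiv.mulLeft y)
  map_one' := by
    ext f x
    change f (1⁻¹ * x) = f x
    simp
  map_mul' y z := by
    ext f x
    change f ((y * z)⁻¹ * x) = f (z⁻¹ * (y⁻¹ * x))
    rw [mul_inv_rev, mul_assoc]

lemma leftRegular_apply (y : G) (f : Ell2 G) (x : G) : leftRegular G y f x = f (y⁻¹ * x) := rfl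

/-- The vector `δ_e ∈ ℓ²(G)`. -/
def deltaOne : Ell2 G := by
  classical exact lp.single 2 1 1

/-- The group von Neumann algebra `VN(G)`: the closure of the span of all `λ(s)` in the weak operator
topology of `B(ℓ²(G))`. -/
def groupVN : Submodule ℂ (Ell2 G →L[ℂ] Ell2 G) :=
  Submodule.comap
    (ContinuousLinearMapWOT.linearEquiv (σ := RingHom.id ℂ) (E := Ell2 G) (F := Ell2 G) ℂ).symm.toLinearMap
    (Submodule.topologicalClosure (Submodule.map
      (ContinuousLinearMapWOT.linearEquiv (σ := RingHom.id ℂ) (E := Ell2 G) (F := Ell2 G) ℂ).symm.toLinearMap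
      (Submodule.span ℂ (Set.range (repOp (leftRegular G))))))

lemma mem_groupVN (T : Ell2 G →L[ℂ] Ell2 G) : T ∈ groupVN G ↔
    ContinuousLinearMapWOT.ofCLM T ∈ closure (ContinuousLinearMapWOT.ofCLM ''
      (Submodule.span ℂ (Set.range (repOp (leftRegular G))) : Set (Ell2 G →L[ℂ] Ell2 G))) :=
  Iff.rfl

/-- A unitary representation of `G`. -/
structure UnitaryRep : Type (u + 1) where
  space : Type u
  [normedAddCommGroup : NormedAddCommGroup space]
  [innerProductSpace : InnerProductSpace ℂ space]
  [completeSpace : CompleteSpace space]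
  rep : G →* (space ≃ₗᵢ[ℂ] space)

attribute [instance] UnitaryRep.normedAddCommGroup UnitaryRep.innerProductSpace
  UnitaryRep.completeSpace

/-- The Hilbert space of the universal representation. -/
abbrev UniversalSpace : Type (u + 1) := lp (fun ρ : UnitaryRep G => ρ.space) 2

/-- The universal representation: the direct sum of all unitary representations of `G`. -/
def universalRep : G →* (UniversalSpace G ≃ₗᵢ[ℂ] UniversalSpace G) where
  toFun g := lpMap fun ρ => ρ.rep g
  map_one' := by ext x ρ; simp
  map_mul' g h := by ext x ρ; simp

/-- The left regular representation as one of the unitary representations. -/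
def leftRegularRep : UnitaryRep G := ⟨Ell2 G, leftRegular G⟩

/-- The vector `δ_e` in the summand `ℓ²(G)` of the universal representation. -/
def universalDeltaOne : UniversalSpace G := by
  classical exact lp.single 2 (leftRegularRep G) (deltaOne G)

lemma orthonormal_leftRegular : Orthonormal ℂ fun s => repOp (leftRegular G) s (deltaOne G) := by
  classical
  have h : ∀ s, repOp (leftRegular G) s (deltaOne G) = lp.single 2 s 1 := fun s => by
    ext x
    change deltaOne G (s⁻¹ * x) = _
    simp only [deltaOne, lp.single_apply, Pi.single_apply, inv_mul_eq_one]
    simp only [eq_comm]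
  rw [orthonormal_iff_ite]
  intro s t
  rw [h, h, lp.inner_single_left]
  simp [lp.single_apply, Pi.single_apply]

lemma orthonormal_universalRep :
    Orthonormal ℂ fun s => repOp (universalRep G) s (universalDeltaOne G) := by
  have h : ∀ s t : G, ⟪universalRep G s (universalDeltaOne G),
      universalRep G t (universalDeltaOne G)⟫_ℂ =
        ⟪leftRegular G s (deltaOne G), leftRegular G t (deltaOne G)⟫_ℂ := fun s t => by
    classical
    rw [lp.inner_eq_tsum, tsum_eq_single (leftRegularRep G) (fun ρ hρ => ?_)]
    · have h1 : universalDeltaOne G (leftRegularRep G) = deltaOne G :=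
        lp.single_apply_self (E := fun ρ : UnitaryRep G => ρ.space) 2 (leftRegularRep G) (deltaOne G)
      change ⟪(leftRegularRep G).rep s (universalDeltaOne G (leftRegularRep G)),
        (leftRegularRep G).rep t (universalDeltaOne G (leftRegularRep G))⟫_ℂ = _
      rw [h1]
      rfl
    · have h1 : universalDeltaOne G ρ = 0 :=
        lp.single_apply_ne (E := fun ρ : UnitaryRep G => ρ.space) 2 (leftRegularRep G) (deltaOne G) hρ
      change ⟪ρ.rep s (universalDeltaOne G ρ), ρ.rep t (universalDeltaOne G ρ)⟫_ℂ = _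
      rw [h1, map_zero, inner_zero_left]
  classical
  rw [orthonormal_iff_ite]
  intro s t
  exact (h s t).trans (orthonormal_iff_ite.1 (orthonormal_leftRegular G) s t)

/-- The full group C*-algebra `C*(G)`: the norm closure of the image `π(ℓ¹(G))` of `ℓ¹(G)` under the
universal representation `π`. As `‖π(f)‖` is the supremum of `‖ρ(f)‖` over all unitary
representations `ρ` of `G`, this is the completion of `ℓ¹(G)` with respect to that norm. -/
def fullGroupCStar : Submodule ℂ (UniversalSpace G →L[ℂ] UniversalSpace G) :=
  (LinearMap.range (Ell1.pairₗ (repOp (universalRep G))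
    (norm_repOp_le (universalRep G)))).topologicalClosure

/-- The `ℓ¹(G)`-module `C*(G)`, with the action `f · π(g) = π(f g)`. -/
def fullGroupCStarModule : CBModule.{u + 1, u} (Ell1 G) :=
  repModule (universalRep G) (orthonormal_universalRep G) (fullGroupCStar G)
    (Submodule.isClosed_topologicalClosure _) fun f T _ =>
      Submodule.le_topologicalClosure _ ⟨_, (coeffMul_eq_integratedForm (universalRep G)
        (orthonormal_universalRep G) f T).symm⟩

variable {G}

/-- The action of `ℓ¹(G)` on `VN(G)`: `f · T = ∑ₛ f(s) ⟨T δ_e, δ_s⟩ λ(s)`. -/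
def vnAct (f : Ell1 G) (T : Ell2 G →L[ℂ] Ell2 G) : Ell2 G →L[ℂ] Ell2 G :=
  coeffMul (leftRegular G) (deltaOne G) f T

/-- A closed `ℓ¹(G)`-submodule `X` of `VN(G)`, with the operator space structure of `VN(G)`, as a
completely bounded left `ℓ¹(G)`-module. -/
def vnSubmodule (X : Submodule ℂ (Ell2 G →L[ℂ] Ell2 G)) (_hVN : X ≤ groupVN G)
    (hX : IsClosed (X : Set (Ell2 G →L[ℂ] Ell2 G))) (hmod : ∀ f, ∀ T ∈ X, vnAct f T ∈ X) :
    CBModule.{u, u} (Ell1 G) :=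
  repModule (leftRegular G) (orthonormal_leftRegular G) X hX hmod

end group
end
end OpMod

/-!
Let `π` be a unitary representation of `G` on `K` with a vector `ξ` whose orbit is orthonormal, and
let `X` be a closed submodule of `B(K)` containing all `π(s)`. Both modules of the theorem are of this
kind: `π = λ`, `ξ = δ_e` for `VN(G)`, and the universal representation with the same vector for
`C*(G)`. Write `T̂(s) = ⟨T ξ, π(s) ξ⟩` for the coefficients of `T`.

*Finite `G`.* Then `X` is spanned by the `π(s)`, and a module map `S : X → F` lifts through a
surjective module map `T : E → F` by `R x = ∑ₛ x̂(s) δ_s · y_s`, where `T y_s = S π(s)`. This is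
completely bounded since the matrix norms are cross norms (`matNorm_smul_const_le`) and the functionals
`x ↦ x̂(s)` are completely contractive. No completely bounded right inverse of `T` is needed
(`isOperatorProjective_repModule`).

*Infinite `G`.* Projectivity is tested on one extension of `X` only. Instead of the free module on
`X` take `E = ℓ¹(G) ⊕ X` with the action `a · (f, T) = (a f + a T̂, 0)` (`extensionModule`) and the
module map `E → X`, `(f, T) ↦ π(f) + T`, which has the completely contractive right inverse
`T ↦ (0, T)`. A module map `R : X → E` splitting it satisfies
`R π(s) = δ_s · R π(s) ∈ ℂ δ_s ⊕ 0`, and therefore `R π(s) = (δ_s, 0)`. So `π(s) ↦ δ_s` is completely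
bounded into `ℓ¹(G)` (`exists_bound_of_isRelativelyOperatorProjective`). This is impossible for
infinite `G` (`finite_of_ell1MatNorm_le`): choose `s_i`, `t_j` (`i, j ≤ n`) such that the `n²` elements
`s_i⁻¹ t_j` are distinct, and let `u` be the `n × n` Fourier matrix. The matrix `[u_ij π(s_i⁻¹ t_j)]` is
`u` multiplied by diagonal unitaries from both sides and has norm at most `√n`, whereas pairing
`[u_ij δ_{s_i⁻¹ t_j}]` with a function that takes the value `conj u_ij` at `s_i⁻¹ t_j` gives the matrix
with all entries `1`, of norm `n`.

The two notions of projectivity need not be treated separately: maps with a completely bounded right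
inverse are admissible, so the finite case uses the stronger notion and the infinite case the weaker.
-/

namespace OpMod

open scoped InnerProductSpace
open OperatorSpace (matNorm)

noncomputable section

universe u v w

/-! ### Completely bounded maps -/

section cb

variable {V : Type*} [NormedAddCommGroup V] [NormedSpace ℂ V] [OperatorSpace V]

lemma matNorm_zero {n : ℕ} : matNorm (0 : Matrix (Fin n) (Fin n) V) = 0 := by
  simpa using OperatorSpace.matNorm_smul (0 : ℂ) (0 : Matrix (Fin n) (Fin n) V)

lemma matNorm_nonneg {n : ℕ} (A : Matrix (Fin n) (Fin n) V) : 0 ≤ matNorm A := by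
  have h := OperatorSpace.matNorm_add_le A ((-1 : ℂ) • A)
  rw [OperatorSpace.matNorm_smul, neg_one_smul, add_neg_cancel, matNorm_zero] at h
  simp only [norm_neg, norm_one, one_mul] at h
  linarith

lemma matNorm_sum_le {ι : Type*} {n : ℕ} (s : Finset ι) (A : ι → Matrix (Fin n) (Fin n) V) :
    matNorm (∑ i ∈ s, A i) ≤ ∑ i ∈ s, matNorm (A i) :=
  Finset.le_sum_of_subadditive _ matNorm_zero.le OperatorSpace.matNorm_add_le _ _

lemma matNorm_diagonal_le (n : ℕ) (x : V) :
    matNorm (Matrix.diagonal fun _ : Fin n => x) ≤ ‖x‖ := by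
  induction n with
  | zero =>
    rw [Subsingleton.elim (Matrix.diagonal fun _ : Fin 0 => x) 0, matNorm_zero]
    exact norm_nonneg x
  | succ n ih =>
    have h : (Matrix.diagonal fun _ : Fin (n + 1) => x) =
        blockDiag (Matrix.diagonal fun _ : Fin n => x) (Matrix.of fun _ _ : Fin 1 => x) := by
      ext1 i j
      obtain ⟨i, rfl⟩ := finSumFinEquiv.surjective i
      obtain ⟨j, rfl⟩ := finSumFinEquiv.surjective j
      rcases i with i | i <;> rcases j with j | j
      · simp [blockDiag, Matrix.diagonal_apply, -finSumFinEquiv_apply_left]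
      · simp [blockDiag, -finSumFinEquiv_apply_left,
          -finSumFinEquiv_apply_right]
      · simp [blockDiag, -finSumFinEquiv_apply_left,
          -finSumFinEquiv_apply_right]
      · simp [blockDiag, Subsingleton.elim i j,
          -finSumFinEquiv_apply_right]
    rw [h, OperatorSpace.matNorm_blockDiag, OperatorSpace.matNorm_one]
    exact max_le ih le_rfl

/-- The matrix norms are cross norms: `‖M ⊗ x‖ ≤ ‖M‖ ‖x‖` for a scalar matrix `M`. -/
lemma matNorm_smul_const_le {n : ℕ} (M : Matrix (Fin n) (Fin n) ℂ) (x : V) :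
    matNorm (Matrix.of fun i j => M i j • x) ≤
      ‖Matrix.toEuclideanCLM (n := Fin n) (𝕜 := ℂ) M‖ * ‖x‖ := by
  have h : (Matrix.of fun i j => M i j • x) = sandwich M (Matrix.diagonal fun _ => x) 1 := by
    ext1 i j
    simp [sandwich, Matrix.diagonal_apply, Matrix.one_apply, mul_ite, ite_smul]
  have h1 : ‖Matrix.toEuclideanCLM (n := Fin n) (𝕜 := ℂ) 1‖ ≤ 1 := by
    rw [map_one]
    exact ContinuousLinearMap.norm_id_le
  rw [h]
  refine (OperatorSpace.matNorm_sandwich_le _ _ _).trans ?_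
  refine (mul_le_of_le_one_right (mul_nonneg (ContinuousLinearMap.opNorm_nonneg _)
    (matNorm_nonneg _)) h1).trans ?_
  exact mul_le_mul_of_nonneg_left (matNorm_diagonal_le n x) (ContinuousLinearMap.opNorm_nonneg _)

variable {W : Type*} [NormedAddCommGroup W] [NormedSpace ℂ W] [OperatorSpace W]

lemma IsCompletelyBounded.exists_nonneg {φ : V →ₗ[ℂ] W} (h : IsCompletelyBounded φ) :
    ∃ C : ℝ, 0 ≤ C ∧ ∀ (n : ℕ) (A : Matrix (Fin n) (Fin n) V),
      matNorm (A.map φ) ≤ C * matNorm A := by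
  obtain ⟨C, hC⟩ := h
  exact ⟨max C 0, le_max_right _ _, fun n A => (hC n A).trans
    (mul_le_mul_of_nonneg_right (le_max_left _ _) (matNorm_nonneg A))⟩

lemma IsCompletelyBounded.comp {U : Type*} [NormedAddCommGroup U] [NormedSpace ℂ U]
    [OperatorSpace U] {ψ : W →ₗ[ℂ] U} {φ : V →ₗ[ℂ] W}
    (hψ : IsCompletelyBounded ψ) (hφ : IsCompletelyBounded φ) :
    IsCompletelyBounded (ψ ∘ₗ φ) := by
  obtain ⟨C, hC0, hC⟩ := hψ.exists_nonneg
  obtain ⟨D, hD⟩ := hφ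
  refine ⟨C * D, fun n A => ?_⟩
  have h : A.map (ψ ∘ₗ φ) = (A.map φ).map ψ := rfl
  rw [h, mul_assoc]
  exact (hC n _).trans (mul_le_mul_of_nonneg_left (hD n A) hC0)

lemma IsCompletelyBounded.sub {φ ψ : V →ₗ[ℂ] W}
    (hφ : IsCompletelyBounded φ) (hψ : IsCompletelyBounded ψ) :
    IsCompletelyBounded (φ - ψ) := by
  obtain ⟨C, hC⟩ := hφ
  obtain ⟨D, hD⟩ := hψ
  refine ⟨C + D, fun n A => ?_⟩
  have h : A.map (φ - ψ) = A.map φ + (-1 : ℂ) • A.map ψ := by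
    ext1 i j
    simp [sub_eq_add_neg]
  have h1 := OperatorSpace.matNorm_add_le (A.map φ) ((-1 : ℂ) • A.map ψ)
  rw [OperatorSpace.matNorm_smul, norm_neg, norm_one, one_mul] at h1
  rw [h]
  linarith [hC n A, hD n A]

lemma isCompletelyBounded_id : IsCompletelyBounded (LinearMap.id : V →ₗ[ℂ] V) :=
  ⟨1, fun n A => by
    have h : A.map (LinearMap.id : V →ₗ[ℂ] V) = A := rfl
    rw [h, one_mul]⟩

end cb

/-- A map with a completely bounded right inverse `σ` is admissible: `1 - σ T` is a completely
bounded projection onto its kernel. -/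
lemma IsOperatorProjective.isRelativelyOperatorProjective {A : Type w} [NonUnitalNormedRing A]
    [NormedSpace ℂ A] [OperatorSpace A] [CCBanachAlgebra A] {X : CBModule.{v, w} A}
    (hX : IsOperatorProjective X) : IsRelativelyOperatorProjective X := by
  rintro E F T hT ⟨σ, hσ, hTσ⟩ S hS
  have h : ∀ y, T (σ y) = y := fun y => LinearMap.congr_fun hTσ y
  have hsurj : Function.Surjective T := fun y => ⟨σ y, h y⟩
  have hrange : LinearMap.range T = ⊤ := LinearMap.range_eq_top.2 hsurj
  refine hX E F T hT ⟨?_, ?_, ?_⟩ hsurj S hS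
  · refine ⟨LinearMap.id - σ ∘ₗ T, isCompletelyBounded_id.sub (hσ.comp hT.1), fun x => ?_,
      fun x hx => ?_⟩
    · simp [h]
    · simp [LinearMap.mem_ker.1 hx]
  · rw [hrange]
    exact isClosed_univ
  · rw [hrange]
    exact ⟨LinearMap.id, isCompletelyBounded_id, fun _ => trivial, fun _ _ => rfl⟩

/-! ### Finite groups -/

section finite

variable {G : Type u}

/-- The point mass `δ_s ∈ ℓ¹(G)`. -/
def Ell1.delta (s : G) : Ell1 G := by
  classical exact lp.single 1 s 1

lemma Ell1.delta_self (s : G) : Ell1.delta s s = 1 := by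
  classical
  simp [Ell1.delta, lp.single_apply]

lemma Ell1.delta_of_ne {s t : G} (h : t ≠ s) : Ell1.delta s t = 0 := by
  classical
  simp [Ell1.delta, lp.single_apply, h]

lemma Ell1.mul_delta (f : Ell1 G) (s : G) : f * Ell1.delta s = f s • Ell1.delta s := by
  ext t
  change f t * Ell1.delta s t = f s * Ell1.delta s t
  by_cases h : t = s
  · rw [h]
  · simp [Ell1.delta_of_ne h]

lemma Ell1.pair_delta {H : Type*} [NormedAddCommGroup H] [InnerProductSpace ℂ H]
    (w : G → (H →L[ℂ] H)) (s : G) : (Ell1.delta s).pair w = w s := by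
  unfold Ell1.pair
  rw [tsum_eq_single s fun t ht => by simp [Ell1.delta_of_ne ht], Ell1.delta_self, one_smul]

variable [Group G] {K : Type v} [NormedAddCommGroup K] [InnerProductSpace ℂ K]
  {π : G →* (K ≃ₗᵢ[ℂ] K)} {ξ : K}

lemma coeff_repOp (hξ : Orthonormal ℂ fun s => repOp π s ξ) (s : G) :
    ⟪repOp π s ξ, repOp π s ξ⟫_ℂ = 1 := by
  classical
  simpa using orthonormal_iff_ite.1 hξ s s

lemma coeffMul_delta_repOp (hξ : Orthonormal ℂ fun s => repOp π s ξ) (s : G) :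
    coeffMul π ξ (Ell1.delta s) (repOp π s) = repOp π s := by
  rw [coeffMul_eq_pair, Ell1.pair_delta, coeff_repOp hξ, one_smul]

lemma sum_coeff_smul_repOp [Fintype G] (hξ : Orthonormal ℂ fun s => repOp π s ξ) {T : K →L[ℂ] K}
    (hT : T ∈ Submodule.span ℂ (Set.range (repOp π))) :
    ∑ s, ⟪repOp π s ξ, T ξ⟫_ℂ • repOp π s = T := by
  classical
  induction hT using Submodule.span_induction with
  | mem x hx =>
    obtain ⟨t, rfl⟩ := hx
    rw [Finset.sum_eq_single t]
    · rw [coeff_repOp hξ, one_smul]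
    · intro s _ hs
      have := orthonormal_iff_ite.1 hξ s t
      rw [if_neg hs] at this
      rw [this, zero_smul]
    · simp
  | zero => simp
  | add x y _ _ hx hy =>
    simp only [add_apply, inner_add_right, add_smul, Finset.sum_add_distrib, hx, hy]
  | smul c x _ hx =>
    simp only [smul_apply, inner_smul_right, mul_smul, ← Finset.smul_sum, hx]

variable [CompleteSpace K]

/-- For finite `G` a lift of `S` sends `π(s)` to `δ_s · y_s`, where `y_s` is any preimage of
`S π(s)`. -/
lemma isOperatorProjective_repModule [Finite G] (hξ : Orthonormal ℂ fun s => repOp π s ξ)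
    (X : Submodule ℂ (K →L[ℂ] K)) (hX : IsClosed (X : Set (K →L[ℂ] K)))
    (hstab : ∀ f, ∀ T ∈ X, coeffMul π ξ f T ∈ X) (hmem : ∀ s, repOp π s ∈ X)
    (hspan : X ≤ Submodule.span ℂ (Set.range (repOp π))) :
    IsOperatorProjective (repModule π hξ X hX hstab) := by
  have := Fintype.ofFinite G
  intro E F T hT _ hsurj S hS
  choose y hy using fun s => hsurj (S (⟨repOp π s, hmem s⟩ : X))
  let φ : G → X →ₗ[ℂ] ℂ := fun s =>
    (innerSL ℂ (repOp π s ξ) ∘L ContinuousLinearMap.apply ℂ K ξ).toLinearMap ∘ₗ X.subtype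
  have hφ : ∀ s (x : X), φ s x = ⟪repOp π s ξ, (x : K →L[ℂ] K) ξ⟫_ℂ := fun s x => rfl
  let z : G → E.carrier := fun s => E.act (Ell1.delta s) (y s)
  let R : X →ₗ[ℂ] E.carrier := ∑ s, (φ s).smulRight (z s)
  have hR : ∀ x, R x = ∑ s, φ s x • z s := fun x => by simp [R]
  have h1 : ‖ξ‖ = 1 := by simpa [repOp] using hξ.1 1
  have h2 : ∀ s, ‖repOp π s ξ‖ = 1 := hξ.1
  refine ⟨R, ⟨⟨∑ s, ‖z s‖, fun n A => ?_⟩, fun a x => ?_⟩, ?_⟩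
  · change Matrix (Fin n) (Fin n) X at A
    have hA : A.map R = ∑ s, Matrix.of fun i j => (A.map (φ s)) i j • z s := by
      ext1 i j
      rw [Matrix.sum_apply]
      exact hR _
    change matNorm (A.map R) ≤ (∑ s, ‖z s‖) * ‖matOp (A.map Subtype.val)‖
    rw [hA, Finset.sum_mul]
    refine (matNorm_sum_le _ _).trans (Finset.sum_le_sum fun s _ => ?_)
    rw [mul_comm]
    refine (matNorm_smul_const_le _ _).trans (mul_le_mul_of_nonneg_right ?_ (norm_nonneg _))
    exact norm_vectorState_le ξ (repOp π s ξ) h1.le (h2 s).le (A.map Subtype.val)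
  · change X at x
    refine (hR _).trans (Eq.trans ?_ (congrArg (E.act a) (hR x)).symm)
    rw [map_sum]
    refine Finset.sum_congr rfl fun s _ => ?_
    have hc : φ s ((repModule π hξ X hX hstab).act a x) = a s * φ s x :=
      coeff_coeffMul π hξ a x s
    have ha : E.act a (z s) = a s • z s := by
      simp only [z]
      rw [← E.act_mul, Ell1.mul_delta, map_smul, LinearMap.smul_apply]
    rw [hc, map_smul, ha, smul_smul, mul_comm]
  · refine LinearMap.ext fun x => ?_
    change X at x
    have hz : ∀ s, T (z s) = S (⟨repOp π s, hmem s⟩ : X) := fun s => by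
      refine (hT.2 _ _).trans ?_
      rw [hy]
      refine (hS.2 _ _).symm.trans ?_
      congr 1
      exact Subtype.ext (coeffMul_delta_repOp hξ s)
    have hx : ∑ s, φ s x • (⟨repOp π s, hmem s⟩ : X) = x := by
      refine Subtype.ext ?_
      simpa [hφ] using sum_coeff_smul_repOp hξ (hspan x.2)
    let S' : X →ₗ[ℂ] F.carrier := S
    change T (R x) = S' x
    conv_rhs => rw [← hx]
    rw [hR, map_sum, map_sum]
    refine Finset.sum_congr rfl fun s _ => ?_
    rw [map_smul, map_smul, hz]
    rfl

end finite

/-! ### An extension of `X` by `ℓ¹(G)` -/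

section prod

variable {V : Type v} [NormedAddCommGroup V] [NormedSpace ℂ V] [OperatorSpace V]
  {W : Type w} [NormedAddCommGroup W] [NormedSpace ℂ W] [OperatorSpace W]

/-- The `ℓ^∞`-direct sum of two operator spaces, `‖(A, B)‖ = max ‖A‖ ‖B‖` on all matrix levels. -/
instance instOperatorSpaceProd : OperatorSpace (V × W) where
  matNorm A := max (matNorm (A.map Prod.fst)) (matNorm (A.map Prod.snd))
  matNorm_add_le A B := by
    rw [Matrix.map_add _ Prod.fst_add, Matrix.map_add _ Prod.snd_add]
    exact (max_le_max (OperatorSpace.matNorm_add_le _ _) (OperatorSpace.matNorm_add_le _ _)).trans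
      max_add_add_le_max_add_max
  matNorm_smul c A := by
    have h1 : (c • A).map Prod.fst = c • A.map Prod.fst := rfl
    have h2 : (c • A).map Prod.snd = c • A.map Prod.snd := rfl
    rw [h1, h2, OperatorSpace.matNorm_smul, OperatorSpace.matNorm_smul,
      mul_max_of_nonneg _ _ (norm_nonneg c)]
  eq_zero_of_matNorm A h := by
    have h1 := OperatorSpace.eq_zero_of_matNorm (A.map Prod.fst)
      (le_antisymm ((le_max_left _ _).trans h.le) (matNorm_nonneg _))
    have h2 := OperatorSpace.eq_zero_of_matNorm (A.map Prod.snd)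
      (le_antisymm ((le_max_right _ _).trans h.le) (matNorm_nonneg _))
    ext1 i j
    exact Prod.ext (congrFun (congrFun h1 i) j) (congrFun (congrFun h2 i) j)
  matNorm_one x := congrArg₂ max (OperatorSpace.matNorm_one x.1) (OperatorSpace.matNorm_one x.2)
  matNorm_blockDiag A B := by
    rw [map_blockDiag _ rfl, map_blockDiag _ rfl, OperatorSpace.matNorm_blockDiag,
      OperatorSpace.matNorm_blockDiag]
    exact max_max_max_comm _ _ _ _
  matNorm_sandwich_le a A b := by
    rw [map_sandwich (LinearMap.fst ℂ V W) Prod.fst fun _ => rfl,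
      map_sandwich (LinearMap.snd ℂ V W) Prod.snd fun _ => rfl]
    refine max_le ((OperatorSpace.matNorm_sandwich_le a _ b).trans ?_)
      ((OperatorSpace.matNorm_sandwich_le a _ b).trans ?_)
    · gcongr
      exact le_max_left _ _
    · gcongr
      exact le_max_right _ _

lemma matNorm_prod {n : ℕ} (A : Matrix (Fin n) (Fin n) (V × W)) :
    matNorm A = max (matNorm (A.map Prod.fst)) (matNorm (A.map Prod.snd)) := rfl

end prod

section extension

variable {G : Type u} [Group G] {K : Type (max u v)} [NormedAddCommGroup K]
  [InnerProductSpace ℂ K] {π : G →* (K ≃ₗᵢ[ℂ] K)} {ξ : K}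

/-- The product in `ℓ¹(G)` of `f` with the bounded function `s ↦ ⟨T ξ, π(s) ξ⟩`, so that
`f · T = π(mulCoeff f T)`. -/
def mulCoeff (hξ : Orthonormal ℂ fun s => repOp π s ξ) (f : Ell1 G) (T : K →L[ℂ] K) : Ell1 G :=
  f.mulBdd (fun s => ⟪repOp π s ξ, T ξ⟫_ℂ) ‖T‖ (norm_coeff_le π hξ T)

lemma mulCoeff_apply (hξ : Orthonormal ℂ fun s => repOp π s ξ) (f : Ell1 G) (T : K →L[ℂ] K)
    (s : G) : mulCoeff hξ f T s = f s * ⟪repOp π s ξ, T ξ⟫_ℂ := rfl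

variable [CompleteSpace K]

lemma ell1MatNorm_ampl_mulCoeff_le (hξ : Orthonormal ℂ fun s => repOp π s ξ)
    (X : Submodule ℂ (K →L[ℂ] K)) {p q : ℕ} (a : Matrix (Fin p) (Fin p) (Ell1 G))
    (x : Matrix (Fin q) (Fin q) X) :
    ell1MatNorm (ampl (fun f (T : X) => mulCoeff hξ f T) a x) ≤ ell1MatNorm a * matNorm x := by
  have h1 : ‖ξ‖ = 1 := by simpa [repOp] using hξ.1 1
  have h2 : ∀ s, ‖repOp π s ξ‖ = 1 := hξ.1
  refine ciSup_le fun v => ?_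
  obtain ⟨m, v, hv⟩ := v
  have h : (ampl (fun f (T : X) => mulCoeff hξ f T) a x).map (Ell1.pair v) =
      ampl (fun f (T : X) =>
        Ell1.pair (fun s => ⟪repOp π s ξ, (T : K →L[ℂ] K) ξ⟫_ℂ • v s) f) a x := by
    ext1 i j
    exact tsum_congr fun s => mul_smul _ _ _
  have h3 := norm_matOp_ampl_le hv (fun s (T : X) => ⟪repOp π s ξ, (T : K →L[ℂ] K) ξ⟫_ℂ) x
    (ContinuousLinearMap.opNorm_nonneg (matOp (x.map Subtype.val)))
    (fun s => norm_vectorState_le ξ (repOp π s ξ) h1.le (h2 s).le (x.map Subtype.val)) a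
  rw [← h] at h3
  exact h3

/-- The module `ℓ¹(G) ⊕ X` with the action `a · (f, T) = (a f + a T̂, 0)`, where
`T̂(s) = ⟨T ξ, π(s) ξ⟩`. It is the quotient of the free module on `X` obtained by identifying
`δ_s ⊗ T` with `T̂(s) δ_s ∈ ℓ¹(G)`. -/
def extensionModule (hξ : Orthonormal ℂ fun s => repOp π s ξ) (X : Submodule ℂ (K →L[ℂ] K))
    (hX : IsClosed (X : Set (K →L[ℂ] K))) : CBModule.{max u v, u} (Ell1 G) where
  carrier := Ell1 G × X
  completeSpace := by
    have := hX.completeSpace_coe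
    infer_instance
  act := LinearMap.mk₂ ℂ (fun a x => (a * x.1 + mulCoeff hξ a x.2, (0 : X)))
    (fun a b x => Prod.ext (by
      ext s
      simp only [Prod.fst_add, lp.coeFn_add, Pi.add_apply, Ell1.mul_apply, mulCoeff_apply]
      ring) (by simp))
    (fun c a x => Prod.ext (by
      ext s
      simp only [Prod.smul_fst, lp.coeFn_add, lp.coeFn_smul, Pi.add_apply, Pi.smul_apply,
        Ell1.mul_apply, mulCoeff_apply, smul_eq_mul]
      ring) (by simp))
    (fun a x y => Prod.ext (by
      ext s
      simp only [Prod.fst_add, Prod.snd_add, lp.coeFn_add, Pi.add_apply, Ell1.mul_apply,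
        mulCoeff_apply, Submodule.coe_add, add_apply, inner_add_right]
      ring) (by simp))
    (fun c a x => Prod.ext (by
      ext s
      simp only [Prod.smul_fst, Prod.smul_snd, lp.coeFn_add, lp.coeFn_smul, Pi.add_apply,
        Pi.smul_apply, Ell1.mul_apply, mulCoeff_apply, Submodule.coe_smul, smul_apply,
        inner_smul_right, smul_eq_mul]
      ring) (by simp))
  act_mul a b x := Prod.ext (by
    ext s
    simp only [LinearMap.mk₂_apply, lp.coeFn_add, Pi.add_apply, Ell1.mul_apply, mulCoeff_apply,
      Submodule.coe_zero, zero_apply, inner_zero_right]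
    ring) rfl
  act_cb := ⟨2, fun p q a x => by
    have h1 : (ampl (fun (a : Ell1 G) (x : Ell1 G × X) =>
          (a * x.1 + mulCoeff hξ a x.2, (0 : X))) a x).map Prod.fst =
        ampl (· * ·) a (x.map Prod.fst) +
          ampl (fun f (T : X) => mulCoeff hξ f T) a (x.map Prod.snd) := rfl
    have h2 : (ampl (fun (a : Ell1 G) (x : Ell1 G × X) =>
          (a * x.1 + mulCoeff hξ a x.2, (0 : X))) a x).map Prod.snd = 0 := rfl
    have h3 := CCBanachAlgebra.matNorm_mul_le p q a (x.map Prod.fst)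
    have h4 : matNorm (ampl (fun f (T : X) => mulCoeff hξ f T) a (x.map Prod.snd)) ≤
        matNorm a * matNorm (x.map Prod.snd) :=
      ell1MatNorm_ampl_mulCoeff_le hξ X a (x.map Prod.snd)
    have h5 : matNorm a * matNorm (x.map Prod.fst) ≤ matNorm a * matNorm x :=
      mul_le_mul_of_nonneg_left (le_max_left _ _) (matNorm_nonneg a)
    have h6 : matNorm a * matNorm (x.map Prod.snd) ≤ matNorm a * matNorm x :=
      mul_le_mul_of_nonneg_left (le_max_right _ _) (matNorm_nonneg a)
    have h7 := mul_nonneg (matNorm_nonneg a) (matNorm_nonneg x)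
    change matNorm (ampl (fun (a : Ell1 G) (x : Ell1 G × X) =>
          (a * x.1 + mulCoeff hξ a x.2, (0 : X))) a x) ≤ _
    rw [matNorm_prod, h1, h2, matNorm_zero]
    refine max_le ?_ (by linarith)
    refine (OperatorSpace.matNorm_add_le _ _).trans ?_
    linarith⟩

/-- If `X` is projective, then `π(s) ↦ δ_s` extends to a completely bounded map on `X`, with values
in an operator space that contains `ℓ¹(G)`. -/
lemma exists_bound_of_isRelativelyOperatorProjective
    (hξ : Orthonormal ℂ fun s => repOp π s ξ) (X : Submodule ℂ (K →L[ℂ] K))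
    (hX : IsClosed (X : Set (K →L[ℂ] K))) (hstab : ∀ f, ∀ T ∈ X, coeffMul π ξ f T ∈ X)
    (hmem : ∀ s, repOp π s ∈ X)
    (hproj : IsRelativelyOperatorProjective (repModule π hξ X hX hstab)) :
    ∃ C : ℝ, ∀ (n : ℕ) (c : Matrix (Fin n) (Fin n) ℂ) (g : Matrix (Fin n) (Fin n) G),
      ell1MatNorm (Matrix.of fun i j => c i j • Ell1.delta (g i j)) ≤
        C * ‖matOp (Matrix.of fun i j => c i j • repOp π (g i j))‖ := by
  have hpair : ∀ f : Ell1 G, f.pair (repOp π) ∈ X := fun f =>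
    hX.mem_of_tendsto (Ell1.summable_pair (norm_repOp_le π) f).hasSum
      (Filter.Eventually.of_forall fun _ =>
        X.sum_mem fun s _ => X.smul_mem _ (hmem s))
  let T₁ : Ell1 G →ₗ[ℂ] X := (Ell1.pairₗ (repOp π) (norm_repOp_le π)).codRestrict X hpair
  let T : Ell1 G × X →ₗ[ℂ] X := T₁.coprod LinearMap.id
  have hT : ∀ x, ((T x : X) : K →L[ℂ] K) = integratedForm π x.1 + x.2 := fun x => rfl
  have hTcb : IsCompletelyBounded T := by
    refine ⟨2, fun n A => ?_⟩
    have h : A.map T = (A.map Prod.fst).map T₁ + A.map Prod.snd := rfl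
    have h1 : matNorm ((A.map Prod.fst).map T₁) ≤ matNorm (A.map Prod.fst) :=
      norm_matOp_pair_le_one (norm_repOp_le π) (A.map Prod.fst)
    have h2 : matNorm (A.map Prod.fst) ≤ matNorm A := le_max_left _ _
    have h3 : matNorm (A.map Prod.snd) ≤ matNorm A := le_max_right _ _
    rw [h]
    refine (OperatorSpace.matNorm_add_le _ _).trans ?_
    linarith
  have hTmod : ∀ (a : Ell1 G) (x : Ell1 G × X),
      T ((extensionModule hξ X hX).act a x) = (repModule π hξ X hX hstab).act a (T x) := by
    intro a x
    refine Subtype.ext ?_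
    have h1 : ((T ((extensionModule hξ X hX).act a x) : X) : K →L[ℂ] K) =
        integratedForm π (a * x.1 + mulCoeff hξ a x.2) := add_zero _
    have h2 : Subtype.val (p := (· ∈ X)) ((repModule π hξ X hX hstab).act a (T x)) =
        integratedForm π (mulCoeff hξ a (T x)) := rfl
    refine h1.trans (Eq.trans ?_ h2.symm)
    congr 1
    ext s
    rw [mulCoeff_apply, hT, lp.coeFn_add, Pi.add_apply, Ell1.mul_apply, mulCoeff_apply,
      add_apply, inner_add_right, coeff_integratedForm π hξ, mul_add]
  obtain ⟨R, ⟨⟨C, hC⟩, hRmod⟩, hTR⟩ := hproj (extensionModule hξ X hX) (repModule π hξ X hX hstab)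
    T ⟨hTcb, hTmod⟩ ⟨LinearMap.inr ℂ (Ell1 G) X, ⟨1, fun n (A : Matrix _ _ X) => by
      have h1 : (A.map (LinearMap.inr ℂ (Ell1 G) X)).map Prod.fst = 0 := rfl
      have h2 : (A.map (LinearMap.inr ℂ (Ell1 G) X)).map Prod.snd = A := rfl
      have h3 : matNorm (A.map (LinearMap.inr ℂ (Ell1 G) X)) ≤ 1 * matNorm A := by
        rw [matNorm_prod, h1, h2, matNorm_zero, one_mul]
        exact max_le (matNorm_nonneg A) le_rfl
      exact h3⟩, LinearMap.coprod_inr _ _⟩ LinearMap.id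
    ⟨isCompletelyBounded_id, fun _ _ => rfl⟩
  let R' : X →ₗ[ℂ] Ell1 G × X := R
  have hR : ∀ s, R' ⟨repOp π s, hmem s⟩ = (Ell1.delta s, 0) := by
    intro s
    set y := R' ⟨repOp π s, hmem s⟩ with hy
    -- The element `π(s) = δ_s · π(s)` is mapped into `δ_s · (ℓ¹(G) ⊕ X) = ℂ δ_s ⊕ 0`.
    have h1 : y = (Ell1.delta s * y.1 + mulCoeff hξ (Ell1.delta s) y.2, 0) := by
      have h2 := hRmod (Ell1.delta s) (⟨repOp π s, hmem s⟩ : X)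
      have h3 : (repModule π hξ X hX hstab).act (Ell1.delta s) (⟨repOp π s, hmem s⟩ : X) =
          (⟨repOp π s, hmem s⟩ : X) := Subtype.ext (coeffMul_delta_repOp hξ s)
      rw [h3] at h2
      exact h2
    obtain ⟨c, hc⟩ : ∃ c : ℂ, y = (c • Ell1.delta s, 0) := by
      refine ⟨y.1 s + ⟪repOp π s ξ, (y.2 : K →L[ℂ] K) ξ⟫_ℂ, h1.trans (Prod.ext ?_ rfl)⟩
      ext t
      by_cases ht : t = s
      · subst ht
        simp [mulCoeff_apply, Ell1.delta_self]
      · simp [mulCoeff_apply, Ell1.delta_of_ne ht]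
    have h4 : ((T y : X) : K →L[ℂ] K) = repOp π s :=
      congrArg Subtype.val (LinearMap.congr_fun hTR (⟨repOp π s, hmem s⟩ : X))
    have h5 : ⟪repOp π s ξ, ((T y : X) : K →L[ℂ] K) ξ⟫_ℂ = c := by
      rw [hT, hc]
      simp [coeff_integratedForm π hξ, Ell1.delta_self]
    rw [h4, coeff_repOp hξ] at h5
    rw [hc, ← h5, one_smul]
  refine ⟨C, fun n c g => ?_⟩
  let A : Matrix (Fin n) (Fin n) X := Matrix.of fun i j => c i j • ⟨repOp π (g i j), hmem _⟩
  have hA : (A.map R').map Prod.fst = Matrix.of fun i j => c i j • Ell1.delta (g i j) := by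
    ext1 i j
    change (R' (c i j • ⟨repOp π (g i j), hmem _⟩)).1 = _
    rw [map_smul, hR]
    rfl
  have h1 : matNorm (A.map R') ≤ C * matNorm A := hC n A
  have h2 : matNorm ((A.map R').map Prod.fst) ≤ matNorm (A.map R') := le_max_left _ _
  rw [hA] at h2
  exact h2.trans h1

end extension

/-! ### Comparison of `ℓ¹(G)` with its image in a representation -/

section fourier

lemma norm_matOp_diagonal_le {ι : Type*} [Fintype ι] [DecidableEq ι] {H : Type*}
    [NormedAddCommGroup H] [InnerProductSpace ℂ H] {u : ι → (H →L[ℂ] H)} (hu : ∀ i, ‖u i‖ ≤ 1) :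
    ‖matOp (Matrix.diagonal u)‖ ≤ 1 := by
  refine ContinuousLinearMap.opNorm_le_bound _ zero_le_one fun z => ?_
  rw [one_mul]
  refine le_of_sq_le_sq ?_ (norm_nonneg _)
  rw [PiLp.norm_sq_eq_of_L2, PiLp.norm_sq_eq_of_L2]
  refine Finset.sum_le_sum fun i _ => ?_
  gcongr
  have h : matOp (Matrix.diagonal u) z i = u i (z i) := by
    rw [matOp_apply, Finset.sum_eq_single i]
    · simp
    · intro j _ hj
      simp [Matrix.diagonal_apply_ne' _ hj]
    · simp
  rw [h]
  exact ((u i).le_opNorm _).trans (mul_le_of_le_one_left (norm_nonneg _) (hu i))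

/-- The Fourier matrix: its entries are unimodular, but its norm is only `√n`. -/
lemma exists_fourierMatrix (n : ℕ) : ∃ u : Matrix (Fin n) (Fin n) ℂ, (∀ i j, ‖u i j‖ = 1) ∧
    ‖Matrix.toEuclideanCLM (n := Fin n) (𝕜 := ℂ) u‖ ≤ √n := by
  rcases Nat.eq_zero_or_pos n with rfl | hn
  · exact ⟨0, fun i => i.elim0, by simp⟩
  obtain ⟨ζ, hζ⟩ : ∃ ζ : ℂ, IsPrimitiveRoot ζ n := ⟨_, Complex.isPrimitiveRoot_exp n hn.ne'⟩
  have hnorm : ‖ζ‖ = 1 := hζ.norm'_eq_one hn.ne'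
  have hζ0 : ζ ≠ 0 := hζ.ne_zero hn.ne'
  have hconj : starRingEnd ℂ ζ = ζ⁻¹ := by
    rw [Complex.inv_def, Complex.normSq_eq_norm_sq, hnorm]
    simp
  let u : Matrix (Fin n) (Fin n) ℂ := Matrix.of fun i j => ζ ^ ((i : ℕ) * (j : ℕ))
  have hu : star u * u = (n : ℂ) • (1 : Matrix (Fin n) (Fin n) ℂ) := by
    ext i k
    have h1 : (star u * u) i k = ∑ j : Fin n, (ζ ^ (k : ℕ) * (ζ ^ (i : ℕ))⁻¹) ^ (j : ℕ) := by
      rw [Matrix.mul_apply]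
      refine Finset.sum_congr rfl fun j _ => ?_
      simp only [Matrix.star_apply, u, Matrix.of_apply, star_pow, RCLike.star_def, hconj]
      rw [mul_pow, inv_pow, inv_pow, ← pow_mul, ← pow_mul, mul_comm (k : ℕ), mul_comm (i : ℕ),
        mul_comm]
    rw [h1, Fin.sum_univ_eq_sum_range (fun j => (ζ ^ (k : ℕ) * (ζ ^ (i : ℕ))⁻¹) ^ j)]
    by_cases hik : i = k
    · subst hik
      simp [hζ0]
    · have hw : ζ ^ (k : ℕ) * (ζ ^ (i : ℕ))⁻¹ ≠ 1 := fun h => hik <| Fin.ext <| Eq.symm <|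
        hζ.pow_inj k.2 i.2 (by simpa using (mul_inv_eq_one₀ (pow_ne_zero _ hζ0)).1 h)
      rw [geom_sum_eq hw, mul_pow, inv_pow, ← pow_mul, ← pow_mul, mul_comm (k : ℕ),
        mul_comm (i : ℕ), pow_mul, pow_mul, hζ.pow_eq_one]
      simp [hik]
  refine ⟨u, fun i j => by simp [u, hnorm], ?_⟩
  let Φ := Matrix.toEuclideanCLM (n := Fin n) (𝕜 := ℂ)
  have h2 : ‖Φ u‖ * ‖Φ u‖ ≤ n := by
    have h3 : star (Φ u) * Φ u = (n : ℂ) • 1 := by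
      rw [← map_star, ← map_mul, hu, map_smul, map_one]
    rw [← CStarRing.norm_star_mul_self, h3, norm_smul, Complex.norm_natCast]
    exact mul_le_of_le_one_right (by positivity) ContinuousLinearMap.norm_id_le
  exact Real.le_sqrt_of_sq_le (by rw [sq]; exact h2)

variable {G : Type u}

/-- Pairing with the bounded function `g_ij ↦ conj c_ij` turns `[c_ij δ_{g_ij}]` into the matrix
with all entries `1`. -/
lemma le_ell1MatNorm_of_injective {n : ℕ} {c : Matrix (Fin n) (Fin n) ℂ} (hc : ∀ i j, ‖c i j‖ = 1)
    {g : Matrix (Fin n) (Fin n) G}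
    (hg : Function.Injective fun p : Fin n × Fin n => g p.1 p.2) :
    (n : ℝ) ≤ ell1MatNorm (Matrix.of fun i j => c i j • Ell1.delta (g i j)) := by
  rcases Nat.eq_zero_or_pos n with rfl | hn
  · simpa using ell1MatNorm_nonneg _
  let v : G → ℂ := Function.extend (fun p : Fin n × Fin n => g p.1 p.2)
    (fun p => starRingEnd ℂ (c p.1 p.2)) 0
  have hv : ∀ i j, v (g i j) = starRingEnd ℂ (c i j) := fun i j => hg.extend_apply _ _ (i, j)
  have hv1 : ∀ s, ‖v s‖ ≤ 1 := fun s => by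
    by_cases h : ∃ p : Fin n × Fin n, g p.1 p.2 = s
    · obtain ⟨p, rfl⟩ := h
      rw [hv, RCLike.norm_conj, hc]
    · simp [v, Function.extend_apply' _ _ _ h]
  refine le_trans ?_ (le_ell1MatNorm _ (scalarFamily v hv1))
  have h1 : (Matrix.of fun i j => c i j • Ell1.delta (g i j)).map
      (Ell1.pair (scalarFamily v hv1).2.1) = Matrix.of fun _ _ => 1 := by
    ext1 i j
    rw [Matrix.map_apply, Matrix.of_apply, Ell1.pair_smul, Ell1.pair_delta]
    change c i j • v (g i j) • (1 : EuclideanSpace ℂ (Fin 1) →L[ℂ] EuclideanSpace ℂ (Fin 1)) = 1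
    rw [smul_smul, hv, Complex.mul_conj', hc]
    simp
  rw [h1]
  let e : EuclideanSpace ℂ (Fin 1) := EuclideanSpace.single 0 1
  let x : PiLp 2 (fun _ : Fin n => EuclideanSpace ℂ (Fin 1)) := WithLp.toLp 2 fun _ => e
  have hx : 0 < ‖x‖ := by
    refine lt_of_lt_of_le ?_ (PiLp.norm_apply_le x ⟨0, hn⟩)
    simp [x, e]
  have h2 : matOp (Matrix.of fun _ _ : Fin n => 1) x = (n : ℂ) • x := by
    ext1 i
    rw [matOp_apply]
    simp [x, Nat.cast_smul_eq_nsmul]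
  have h3 := (matOp (Matrix.of fun _ _ : Fin n => 1)).le_opNorm x
  rw [h2, norm_smul, Complex.norm_natCast] at h3
  exact le_of_mul_le_mul_right h3 hx

variable [Group G]

/-- Products of `n` elements with `n` elements of an infinite group may be pairwise distinct. -/
lemma exists_injective_inv_mul [Infinite G] (n : ℕ) : ∃ s t : Fin n → G,
    Function.Injective fun p : Fin n × Fin n => (s p.1)⁻¹ * t p.2 := by
  classical
  let s : Fin n → G := fun i => Infinite.natEmbedding G i
  have hs : Function.Injective s := (Infinite.natEmbedding G).injective.comp Fin.val_injective
  obtain ⟨t, -, ht⟩ := exists_seq_of_forall_finset_exists (fun _ : G => True)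
    (fun x y => ∀ i j, (s i)⁻¹ * x ≠ (s j)⁻¹ * y) fun F _ => by
      obtain ⟨y, hy⟩ := Infinite.exists_notMem_finset
        ((F ×ˢ (Finset.univ : Finset (Fin n × Fin n))).image
          fun q => s q.2.2 * ((s q.2.1)⁻¹ * q.1))
      refine ⟨y, trivial, fun x hx i j h => hy ?_⟩
      exact Finset.mem_image.2 ⟨(x, (i, j)), by simp [hx], by simp [h]⟩
  refine ⟨s, fun j => t j, ?_⟩
  rintro ⟨i, j⟩ ⟨i', j'⟩ h
  change (s i)⁻¹ * t j = (s i')⁻¹ * t j' at h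
  rcases lt_trichotomy j j' with hj | hj | hj
  · exact (ht _ _ hj _ _ h).elim
  · subst hj
    rw [hs (inv_injective (mul_right_cancel h))]
  · exact (ht _ _ hj _ _ h.symm).elim

variable {K : Type v} [NormedAddCommGroup K] [InnerProductSpace ℂ K] [CompleteSpace K]

/-- `[c_ij π(s_i⁻¹ t_j)]` is the product of `c` with two diagonal unitaries. -/
lemma norm_matOp_smul_repOp_le (π : G →* (K ≃ₗᵢ[ℂ] K)) {n : ℕ} (c : Matrix (Fin n) (Fin n) ℂ)
    (s t : Fin n → G) : ‖matOp (Matrix.of fun i j => c i j • repOp π ((s i)⁻¹ * t j))‖ ≤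
      ‖Matrix.toEuclideanCLM (n := Fin n) (𝕜 := ℂ) c‖ := by
  have h : (Matrix.of fun i j => c i j • repOp π ((s i)⁻¹ * t j)) =
      Matrix.diagonal (fun i => repOp π (s i)⁻¹) * scalarMat c *
        Matrix.diagonal (fun j => repOp π (t j)) := by
    ext i j x
    rw [Matrix.mul_diagonal, Matrix.diagonal_mul]
    simp [scalarMat, repOp]
  rw [h, matOp_mul, matOp_mul]
  refine (ContinuousLinearMap.opNorm_comp_le _ _).trans
    ((mul_le_of_le_one_right (ContinuousLinearMap.opNorm_nonneg _)
      (norm_matOp_diagonal_le fun j => norm_repOp_le π _)).trans ?_)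
  exact (ContinuousLinearMap.opNorm_comp_le _ _).trans
    ((mul_le_of_le_one_left (ContinuousLinearMap.opNorm_nonneg _)
      (norm_matOp_diagonal_le fun j => norm_repOp_le π _)).trans (norm_scalarMat_le c))

/-- For infinite `G` the map `π(s) ↦ δ_s` into `ℓ¹(G)` is not completely bounded. -/
lemma finite_of_ell1MatNorm_le (π : G →* (K ≃ₗᵢ[ℂ] K))
    (h : ∃ C : ℝ, ∀ (n : ℕ) (c : Matrix (Fin n) (Fin n) ℂ) (g : Matrix (Fin n) (Fin n) G),
      ell1MatNorm (Matrix.of fun i j => c i j • Ell1.delta (g i j)) ≤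
        C * ‖matOp (Matrix.of fun i j => c i j • repOp π (g i j))‖) : Finite G := by
  obtain ⟨C, hC⟩ := h
  by_contra hG
  have : Infinite G := not_finite_iff_infinite.1 hG
  obtain ⟨m, hm⟩ := exists_nat_gt (max C 1)
  have hm1 : (1 : ℝ) < m := (le_max_right _ _).trans_lt hm
  -- The two sides grow as `n` and `√n`; for `n = m²` with `m > C` they contradict each other.
  obtain ⟨c, hc, hcn⟩ := exists_fourierMatrix (m ^ 2)
  obtain ⟨s, t, hst⟩ := exists_injective_inv_mul (G := G) (m ^ 2)
  have h1 := le_ell1MatNorm_of_injective hc (g := Matrix.of fun i j => (s i)⁻¹ * t j) hst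
  have h2 := (h1.trans (hC _ _ _)).trans (mul_le_mul_of_nonneg_right (le_max_left C 1)
    (ContinuousLinearMap.opNorm_nonneg _))
  have h3 := (norm_matOp_smul_repOp_le π c s t).trans hcn
  push_cast at h2 h3
  rw [Real.sqrt_sq (by linarith)] at h3
  have h4 := h2.trans (mul_le_mul_of_nonneg_left h3 (zero_le_one.trans (le_max_right C 1)))
  nlinarith

end fourier

/-! ### The modules over `VN(G)` and `C*(G)` -/

section modules

lemma finite_of_isRelativelyOperatorProjective {G : Type u} [Group G] {K : Type (max u v)}
    [NormedAddCommGroup K] [InnerProductSpace ℂ K] [CompleteSpace K] {π : G →* (K ≃ₗᵢ[ℂ] K)} {ξ : K}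
    (hξ : Orthonormal ℂ fun s => repOp π s ξ) (X : Submodule ℂ (K →L[ℂ] K))
    (hX : IsClosed (X : Set (K →L[ℂ] K))) (hstab : ∀ f, ∀ T ∈ X, coeffMul π ξ f T ∈ X)
    (hmem : ∀ s, repOp π s ∈ X)
    (hproj : IsRelativelyOperatorProjective (repModule π hξ X hX hstab)) : Finite G :=
  finite_of_ell1MatNorm_le π
    (exists_bound_of_isRelativelyOperatorProjective.{u, v} hξ X hX hstab hmem hproj)

lemma projective_iff_finite {G : Type u} [Group G] {K : Type (max u v)}
    [NormedAddCommGroup K] [InnerProductSpace ℂ K] [CompleteSpace K] {π : G →* (K ≃ₗᵢ[ℂ] K)} {ξ : K}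
    (hξ : Orthonormal ℂ fun s => repOp π s ξ) (X : Submodule ℂ (K →L[ℂ] K))
    (hX : IsClosed (X : Set (K →L[ℂ] K))) (hstab : ∀ f, ∀ T ∈ X, coeffMul π ξ f T ∈ X)
    (hmem : ∀ s, repOp π s ∈ X)
    (hspan : Finite G → X ≤ Submodule.span ℂ (Set.range (repOp π))) :
    (IsOperatorProjective (repModule π hξ X hX hstab) ↔ Finite G) ∧
      (IsRelativelyOperatorProjective (repModule π hξ X hX hstab) ↔ Finite G) := by
  have h1 : Finite G → IsOperatorProjective (repModule π hξ X hX hstab) := fun hG =>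
    isOperatorProjective_repModule hξ X hX hstab hmem (hspan hG)
  have h2 : IsRelativelyOperatorProjective (repModule π hξ X hX hstab) → Finite G :=
    finite_of_isRelativelyOperatorProjective.{u, v} hξ X hX hstab hmem
  exact ⟨⟨fun h => h2 h.isRelativelyOperatorProjective, h1⟩,
    ⟨h2, fun h => (h1 h).isRelativelyOperatorProjective⟩⟩

variable (G : Type u) [Group G]

/-- A finite-dimensional subspace is closed in the weak operator topology. -/
lemma groupVN_le_span [Finite G] :
    groupVN G ≤ Submodule.span ℂ (Set.range (repOp (leftRegular G))) := by
  have : FiniteDimensional ℂ (Submodule.span ℂ (Set.range (repOp (leftRegular G)))) :=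
    FiniteDimensional.span_of_finite ℂ (Set.finite_range _)
  intro T hT
  have hclosed := Submodule.closed_of_finiteDimensional (Submodule.map
    (ContinuousLinearMapWOT.linearEquiv (σ := RingHom.id ℂ) (E := Ell2 G) (F := Ell2 G)
      ℂ).symm.toLinearMap (Submodule.span ℂ (Set.range (repOp (leftRegular G)))))
  change _ ∈ Submodule.topologicalClosure _ at hT
  rw [hclosed.submodule_topologicalClosure_eq] at hT
  obtain ⟨S, hS, hST⟩ := hT
  rwa [← LinearEquiv.injective _ hST]

lemma repOp_mem_fullGroupCStar (s : G) : repOp (universalRep G) s ∈ fullGroupCStar G :=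
  Submodule.le_topologicalClosure _ ⟨Ell1.delta s, Ell1.pair_delta _ s⟩

lemma fullGroupCStar_le_span [Finite G] :
    fullGroupCStar G ≤ Submodule.span ℂ (Set.range (repOp (universalRep G))) := by
  have := Fintype.ofFinite G
  have : FiniteDimensional ℂ (Submodule.span ℂ (Set.range (repOp (universalRep G)))) :=
    FiniteDimensional.span_of_finite ℂ (Set.finite_range _)
  refine Submodule.topologicalClosure_minimal _ ?_ (Submodule.closed_of_finiteDimensional _)
  rintro _ ⟨f, rfl⟩
  change f.pair (repOp (universalRep G)) ∈ _
  rw [Ell1.pair, tsum_fintype]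
  exact Submodule.sum_mem _ fun s _ => Submodule.smul_mem _ _ (Submodule.subset_span ⟨s, rfl⟩)

lemma fullGroupCStarModule_projective_iff_finite :
    (IsOperatorProjective (fullGroupCStarModule G) ↔ Finite G) ∧
      (IsRelativelyOperatorProjective (fullGroupCStarModule G) ↔ Finite G) :=
  projective_iff_finite.{u, u + 1} (orthonormal_universalRep G) (fullGroupCStar G) _ _
    (repOp_mem_fullGroupCStar G) fun _ => fullGroupCStar_le_span G

end modules

end

end OpMod

theorem mainTheorem10 {G : Type*} [Group G] :
    (∀ (X : Submodule ℂ (OpMod.Ell2 G →L[ℂ] OpMod.Ell2 G)) (hVN : X ≤ OpMod.groupVN G)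
        (hX : IsClosed (X : Set (OpMod.Ell2 G →L[ℂ] OpMod.Ell2 G)))
        (hmod : ∀ f, ∀ T ∈ X, OpMod.vnAct f T ∈ X),
        (∀ s, OpMod.repOp (OpMod.leftRegular G) s ∈ X) →
          (OpMod.IsOperatorProjective (OpMod.vnSubmodule X hVN hX hmod) ↔ Finite G) ∧
          (OpMod.IsRelativelyOperatorProjective (OpMod.vnSubmodule X hVN hX hmod) ↔ Finite G)) ∧
      (OpMod.IsOperatorProjective (OpMod.fullGroupCStarModule G) ↔ Finite G) ∧
      (OpMod.IsRelativelyOperatorProjective (OpMod.fullGroupCStarModule G) ↔ Finite G) :=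
  ⟨fun X hVN hX hmod hmem =>
    OpMod.projective_iff_finite (OpMod.orthonormal_leftRegular G) X hX hmod hmem
      fun _ => hVN.trans (OpMod.groupVN_le_span G),
    OpMod.fullGroupCStarModule_projective_iff_finite G⟩
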